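/- **Setting.** A signature $\Theta$ has a non-empty set of predicate symbols of arity $\ge 1$ and a (possibly empty) set $C$ of individual constants; there are no function symbols and no identity. Formulas are built from atoms by $\neg,\Box,\to,\forall x$ over denumerably many variables; $\exists x\,\varphi$ abbreviates $\neg\forall x\,\neg\varphi$. Write $\varphi\sim\psi$ (variants) if one is obtained from the other by adding or deleting void quantifiers ($\forall x$ or $\exists x$ in front of a formula in which $x$ is not free) and by renaming bound variables, at any places in the formula. There are four truth values $T,t,f,F$; $T,t$ are designated. **Semantics.** $\tilde\neg$ sends $T,t,f,F$ to $F,f,t,T$. The values of $a\,\tilde\to\, b$ are: $\{T\}$ if $a=F$ or $b=T$; $\{b\}$ if $a=T$; $t\tilde\to t=f\tilde\to t=f\tilde\to f=\{T,t\}$; $t\tilde\to f=t\tilde\to F=\{f\}$; $f\tilde\to F=\{t\}$. In both logics $\tilde\Box T=\{T\}$; for $a\ne T$, $\tilde\Box a=\{f,F\}$ in $\mathbf{S4m}^*$ and $\tilde\Box a=\{F\}$ in $\mathbf{S5m}^*$. For a non-empty set $X$ of values, $\tilde\forall(X)$ is the minimum of $X$ in the chain $F\le f\le t\le T$. A structure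 $\mathfrak A$ over $\Theta$ has a non-empty domain $U$, functions $P^{\mathfrak A}:U^n\to\{T,t,f,F\}$ and elements $c^{\mathfrak A}\in U$; $\Theta_U$ adds to $\Theta$ a new constant $\bar a$, denoting $a$, for each $a\in U$ that is not denoted by a constant of $\Theta$. For $L\in\{\mathbf{S4m}^*,\mathbf{S5m}^*\}$, an $L$-valuation over $\mathfrak A$ is a function $v$ from the closed formulas over $\Theta_U$ to $\{T,t,f,F\}$ with $v(Pc_1\ldots c_n)=P^{\mathfrak A}(c_1^{\mathfrak A},\ldots,c_n^{\mathfrak A})$, $v(\neg\varphi)\in\tilde\neg v(\varphi)$, $v(\Box\varphi)\in\tilde\Box v(\varphi)$, $v(\varphi\to\psi)\in v(\varphi)\,\tilde\to\,v(\psi)$, $v(\forall x\varphi)=\tilde\forall(\{v(\varphi[x/c]) : c \text{ a constant of }\Theta_U\})$, and $v(\varphi)=v(\psi)$ whenever $\varphi\sim\psi$. For closed formulas, $\Gamma\models_L\varphi$ means: for every $\mathfrak A$ and every $L$-valuation $v$ over $\mathfrak A$, if $v(\gamma)$ is designated for all $\gamma\in\Gamma$, then $v(\varphi)$ is designated. **Tableaux.**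 Let $\bar C$ be a denumerable set of new constants. Tableaux consist of signed formulas $\mathsf L{:}\varphi$, with $\mathsf L\in\{T,t,f,F\}$ and $\varphi$ a closed formula over $\Theta$ with the constants $\bar C$ added. The rules are ($\mid$ separates alternatives, i.e. new branches): - $T{:}\neg\varphi\,/\,F{:}\varphi$; $\;t{:}\neg\varphi\,/\,f{:}\varphi$; $\;f{:}\neg\varphi\,/\,t{:}\varphi$; $\;F{:}\neg\varphi\,/\,T{:}\varphi$. - $T{:}(\varphi\to\psi)\,/\,F{:}\varphi\mid t{:}\varphi,t{:}\psi\mid f{:}\varphi,t{:}\psi\mid f{:}\varphi,f{:}\psi\mid T{:}\psi$. - $t{:}(\varphi\to\psi)\,/\,T{:}\varphi,t{:}\psi\mid t{:}\varphi,t{:}\psi\mid f{:}\varphi,t{:}\psi\mid f{:}\varphi,f{:}\psi\mid f{:}\varphi,F{:}\psi$. - $f{:}(\varphi\to\psi)\,/\,T{:}\varphi,f{:}\psi\mid t{:}\varphi,f{:}\psi\mid t{:}\varphi,F{:}\psi$; $\;F{:}(\varphi\to\psi)\,/\,T{:}\varphi,F{:}\psi$. - $T{:}\Box\varphi\,/\,T{:}\varphi$;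 $\;t{:}\Box\varphi$ closes the branch; $\;F{:}\Box\varphi\,/\,t{:}\varphi\mid f{:}\varphi\mid F{:}\varphi$; and $f{:}\Box\varphi\,/\,t{:}\varphi\mid f{:}\varphi\mid F{:}\varphi$ in $\mathbf{S4m}^*$, whereas $f{:}\Box\varphi$ closes the branch in $\mathbf{S5m}^*$. - $T{:}\forall x\varphi\,/\,T{:}\varphi(c)$ for any constant $c$, reusable; $\;F{:}\forall x\varphi\,/\,F{:}\varphi(c)$ with $c$ new on the branch, only once on each branch. - $t{:}\forall x\varphi\,/\,t{:}\varphi(c),t{:}\varphi(c')\mid t{:}\varphi(c),T{:}\varphi(c')$ with $c$ new on the branch and $c'\neq c$ any constant; later, on the same branch, it can be reused to split it into $t{:}\varphi(c'')\mid T{:}\varphi(c'')$ for any constant $c''\ne c$. - $f{:}\forall x\varphi\,/\,f{:}\varphi(c),f{:}\varphi(c')\mid f{:}\varphi(c),T{:}\varphi(c')\mid f{:}\varphi(c),t{:}\varphi(c')$ with $c$ new on the branch and $c'\neq c$ any constant; later, on the same branch, it can be reused to split it into $f{:}\varphi(c'')\mid T{:}\varphi(c'')\mid t{:}\varphi(c'')$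 for any constant $c''\ne c$. A branch is also closed if it contains $\mathsf L{:}\varphi$ and $\mathsf L'{:}\varphi'$ with $\varphi\sim\varphi'$ and $\mathsf L\ne\mathsf L'$; a tableau is closed if all its branches are. A closed formula $\varphi$ over $\Theta$ is tableau-provable in $L$ if there are closed (finite) tableaux starting from $F{:}\varphi$ and from $f{:}\varphi$; $\varphi$ is tableau-provable from $\Gamma=\{\gamma_1,\ldots,\gamma_n\}$ in $L$, written $\Gamma\models_{\mathcal T(L)}\varphi$, if $\gamma_1\to(\gamma_2\to\cdots\to(\gamma_n\to\varphi)\cdots)$ is tableau-provable in $L$. **Theorem (soundness and completeness of tableaux for $\mathbf{S4m}^*$ and $\mathbf{S5m}^*$).** Let $L\in\{\mathbf{S4m}^*,\mathbf{S5m}^*\}$ and let $\Gamma\cup\{\varphi\}$ be a finite set of closed formulas over $\Theta$. Then, whatever the enumeration of $\Gamma$, $\Gamma\models_L\varphi$ if and only if $\Gamma\models_{\mathcal T(L)}\varphi$. -/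

import Mathlib

universe u v w

namespace Ivlev

/-! ## Truth values and multioperators -/

/-- The four truth values: necessarily true, contingently true, contingently false,
necessarily false. -/
inductive TV : Type
  | T | t | f | F

/-- The designated values. -/
def Designated : Set TV := {TV.T, TV.t}

/-- The two logics treated here (first-order, without identity and function symbols). -/
inductive Logic : Type
  | S4m | S5m

/-- The (deterministic) multioperator of negation. -/
def negOp : TV → Set TV
  | .T => {.F}
  | .t => {.f}
  | .f => {.t}
  | .F => {.T}

/-- The non-deterministic multioperator of implication. -/
def impOp : TV → TV → Set TV
  | _, .T => {.T}
  | .F, _ => {.T}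
  | .T, .t => {.t}
  | .T, .f => {.f}
  | .T, .F => {.F}
  | .t, .t => {.T, .t}
  | .t, .f => {.f}
  | .t, .F => {.f}
  | .f, .t => {.T, .t}
  | .f, .f => {.T, .t}
  | .f, .F => {.t}

/-- The multioperator of the box in each of the two logics. -/
def boxOp : Logic → TV → Set TV
  | _, .T => {.T}
  | .S4m, _ => {.f, .F}
  | .S5m, _ => {.F}

open Classical in
/-- The deterministic multioperator of the universal quantifier on (non-empty) sets of values:
the least element of the set for the chain `F ≤ f ≤ t ≤ T`. -/
noncomputable def allOp (X : Set TV) : Set TV :=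
  if TV.F ∈ X then {.F}
  else if TV.f ∈ X then {.f}
  else if TV.t ∈ X then {.t}
  else {.T}

/-! ## Languages -/

/-- A basic predicate signature: a non-empty collection of predicate symbols of positive arity
and a possibly empty collection of individual constants. -/
structure Signature : Type (max (u + 1) (v + 1)) where
  Pred : Type u
  Const : Type v
  arity : Pred → ℕ
  pred_nonempty : Nonempty Pred
  arity_pos : ∀ p, 1 ≤ arity p

/-- The signature obtained by adding the elements of `D` as new constants. -/
def Signature.extend (Θ : Signature.{u, v}) (D : Type w) : Signature.{u, max v w} where
  Pred := Θ.Pred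
  Const := Θ.Const ⊕ D
  arity := Θ.arity
  pred_nonempty := Θ.pred_nonempty
  arity_pos := Θ.arity_pos

/-- Terms: individual variables `x_n` and constants. -/
inductive Term (K : Type v) : Type v
  | var (n : ℕ)
  | const (c : K)

/-- Well-formed formulas over `Θ`. -/
inductive Formula (Θ : Signature.{u, v}) : Type (max u v)
  | atom (p : Θ.Pred) (τ : Fin (Θ.arity p) → Term Θ.Const)
  | neg (φ : Formula Θ)
  | box (φ : Formula Θ)
  | imp (φ ψ : Formula Θ)
  | all (x : ℕ) (φ : Formula Θ)

/-- Replacing the constants of a term. -/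
def Term.map {K : Type v} {K' : Type w} (g : K → K') : Term K → Term K'
  | .var n => .var n
  | .const c => .const (g c)

namespace Formula

variable {Θ : Signature.{u, v}}

/-- The variables that occur free in a formula. -/
def freeVars : Formula Θ → Set ℕ
  | .atom _ τ => {n | ∃ i, τ i = Term.var n}
  | .neg φ => φ.freeVars
  | .box φ => φ.freeVars
  | .imp φ ψ => φ.freeVars ∪ ψ.freeVars
  | .all x φ => φ.freeVars \ {x}

/-- Closed formulas (sentences). -/
def Closed (φ : Formula Θ) : Prop := φ.freeVars = ∅

/-- The constants that occur in a formula. -/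
def consts : Formula Θ → Set Θ.Const
  | .atom _ τ => {c | ∃ i, τ i = Term.const c}
  | .neg φ => φ.consts
  | .box φ => φ.consts
  | .imp φ ψ => φ.consts ∪ ψ.consts
  | .all _ φ => φ.consts

/-- Simultaneous replacement of the free occurrences of every variable `x_n` by the term `σ n`.
(It is only used where no variable is captured.) -/
def subst (σ : ℕ → Term Θ.Const) : Formula Θ → Formula Θ
  | .atom p τ => .atom p fun i =>
      match τ i with
      | .var n => σ n
      | .const c => .const c
  | .neg φ => .neg (φ.subst σ)
  | .box φ => .box (φ.subst σ)
  | .imp φ ψ => .imp (φ.subst σ) (ψ.subst σ)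
  | .all x φ => .all x (φ.subst (Function.update σ x (Term.var x)))

/-- `φ.subst₁ x τ` is `φ[x/τ]`. -/
def subst₁ (x : ℕ) (τ : Term Θ.Const) (φ : Formula Θ) : Formula Θ :=
  φ.subst (Function.update Term.var x τ)

/-- The variable `y` is free for the variable `x` in a formula: no free occurrence of `x` lies in
the scope of a quantifier `∀ y`. -/
def FreeFor (y x : ℕ) : Formula Θ → Prop
  | .atom _ _ => True
  | .neg φ => φ.FreeFor y x
  | .box φ => φ.FreeFor y x
  | .imp φ ψ => φ.FreeFor y x ∧ ψ.FreeFor y x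
  | .all z φ => x ∉ (Formula.all z φ).freeVars ∨ (z ≠ y ∧ φ.FreeFor y x)

/-- `φ ∼ ψ`: the formulas are variants of each other, that is, each can be obtained from the other
by adding or deleting void quantifiers `∀ x`, `∃ x` (where `∃ x φ` stands for `¬ ∀ x ¬ φ`) and by
renaming bound variables, at any place inside the formula. -/
inductive Variant : Formula Θ → Formula Θ → Prop
  | voidAll (x : ℕ) (φ : Formula Θ) (h : x ∉ φ.freeVars) : Variant (.all x φ) φ
  | voidEx (x : ℕ) (φ : Formula Θ) (h : x ∉ φ.freeVars) : Variant (.neg (.all x (.neg φ))) φ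
  | rename (x y : ℕ) (φ : Formula Θ) (hy : y ∉ φ.freeVars) (hf : φ.FreeFor y x) :
      Variant (.all x φ) (.all y (φ.subst₁ x (Term.var y)))
  | neg {φ φ' : Formula Θ} (h : Variant φ φ') : Variant (.neg φ) (.neg φ')
  | box {φ φ' : Formula Θ} (h : Variant φ φ') : Variant (.box φ) (.box φ')
  | imp {φ φ' ψ ψ' : Formula Θ} (h : Variant φ φ') (h' : Variant ψ ψ') :
      Variant (.imp φ ψ) (.imp φ' ψ')
  | all (x : ℕ) {φ φ' : Formula Θ} (h : Variant φ φ') : Variant (.all x φ) (.all x φ')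
  | refl (φ : Formula Θ) : Variant φ φ
  | symm {φ ψ : Formula Θ} (h : Variant φ ψ) : Variant ψ φ
  | trans {φ ψ χ : Formula Θ} (h : Variant φ ψ) (h' : Variant ψ χ) : Variant φ χ

/-- A formula over `Θ`, seen as a formula over a signature with more constants. -/
def lift (D : Type w) : Formula Θ → Formula (Θ.extend D)
  | .atom p τ => .atom (Θ := Θ.extend D) p fun i => (τ i).map Sum.inl
  | .neg φ => .neg (φ.lift D)
  | .box φ => .box (φ.lift D)
  | .imp φ ψ => .imp (φ.lift D) (ψ.lift D)
  | .all x φ => .all x (φ.lift D)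

/-- `impChain [γ₁, …, γₙ] φ` is `γ₁ → (γ₂ → … → (γₙ → φ) …)`. -/
def impChain (Γ : List (Formula Θ)) (φ : Formula Θ) : Formula Θ := Γ.foldr .imp φ

end Formula

/-! ## Semantics -/

/-- A four-valued modal structure over `Θ`. -/
structure ModalStructure (Θ : Signature.{u, v}) : Type (max u v (w + 1)) where
  U : Type w
  nonempty : Nonempty U
  pred : ∀ p : Θ.Pred, (Fin (Θ.arity p) → U) → TV
  const : Θ.Const → U

namespace ModalStructure

variable {Θ : Signature.{u, v}} (A : ModalStructure.{u, v, w} Θ)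

/-- The new names: one for every element of the domain that is not the value of a constant. -/
abbrev NewName : Type w := {a : A.U // a ∉ Set.range A.const}

/-- The diagram signature `Θ_U`. -/
abbrev diagram : Signature.{u, max v w} := Θ.extend A.NewName

/-- The interpretation of the constants of the diagram signature. -/
def constU : A.diagram.Const → A.U
  | .inl c => A.const c
  | .inr a => a.1

/-- Valuations of the logic `L` over `A`. Only the values at closed formulas of the diagram
signature are constrained, and only those values are ever used. -/
structure IsValuation (L : Logic) (val : Formula A.diagram → TV) : Prop where
  atom : ∀ (p : Θ.Pred) (c : Fin (Θ.arity p) → A.diagram.Const),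
    val (.atom (Θ := A.diagram) p fun i => Term.const (c i)) = A.pred p fun i => A.constU (c i)
  neg : ∀ φ : Formula A.diagram, φ.Closed → val (.neg φ) ∈ negOp (val φ)
  box : ∀ φ : Formula A.diagram, φ.Closed → val (.box φ) ∈ boxOp L (val φ)
  imp : ∀ φ ψ : Formula A.diagram, φ.Closed → ψ.Closed →
    val (.imp φ ψ) ∈ impOp (val φ) (val ψ)
  all : ∀ (x : ℕ) (φ : Formula A.diagram), (Formula.all x φ).Closed →
    val (.all x φ) ∈ allOp {l | ∃ c : A.diagram.Const, l = val (φ.subst₁ x (Term.const c))}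
  variant : ∀ φ ψ : Formula A.diagram, φ.Closed → ψ.Closed → φ.Variant ψ → val φ = val ψ

end ModalStructure

/-- Semantic consequence in the logic `L`: the free variables are instantiated in all possible ways
by constants of the diagram signature, both in the premises and in the conclusion. -/
def SemCons {Θ : Signature.{u, v}} (L : Logic) (Γ : Set (Formula Θ)) (φ : Formula Θ) : Prop :=
  ∀ (A : ModalStructure.{u, v, w} Θ) (val : Formula A.diagram → TV), A.IsValuation L val →
    (∀ γ ∈ Γ, ∀ c : ℕ → A.diagram.Const,
      val ((γ.lift A.NewName).subst fun n => Term.const (c n)) ∈ Designated) →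
    ∀ c : ℕ → A.diagram.Const,
      val ((φ.lift A.NewName).subst fun n => Term.const (c n)) ∈ Designated

/-! ## Tableaux -/

section Tableaux

variable {Θ : Signature.{u, v}}

/-- Entries of a branch: signed formulas `l : φ`, and marks `l : ∀ x φ : [c]` which record that the
rule for the signed formula `l : ∀ x φ` was used on this branch with the fresh constant `c`. -/
inductive Entry (Θ : Signature.{u, v}) : Type (max u v)
  | signed (l : TV) (φ : Formula Θ)
  | marked (l : TV) (x : ℕ) (φ : Formula Θ) (c : Θ.Const)

/-- The constants that appear in an entry. -/
def Entry.consts : Entry Θ → Set Θ.Const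
  | .signed _ φ => φ.consts
  | .marked _ _ φ c => insert c φ.consts

/-- A branch, as the list of its entries from the root downwards. -/
abbrev Branch (Θ : Signature.{u, v}) : Type (max u v) := List (Entry Θ)

/-- The constant `c` has not yet appeared in the branch. -/
def Fresh (c : Θ.Const) (θ : Branch Θ) : Prop := ∀ e ∈ θ, c ∉ e.consts

open Entry in
/-- The tableau rules for the connectives: from the signed formula `l : φ` to the list of
alternatives, each of which is a list of signed formulas. The rules whose effect is that the branch
closes are part of the definition of a closed branch. -/
inductive PropRule (L : Logic) : TV → Formula Θ → List (List (Entry Θ)) → Prop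
  | negT (φ : Formula Θ) : PropRule L .T (.neg φ) [[signed .F φ]]
  | negt (φ : Formula Θ) : PropRule L .t (.neg φ) [[signed .f φ]]
  | negf (φ : Formula Θ) : PropRule L .f (.neg φ) [[signed .t φ]]
  | negF (φ : Formula Θ) : PropRule L .F (.neg φ) [[signed .T φ]]
  | boxT (φ : Formula Θ) : PropRule L .T (.box φ) [[signed .T φ]]
  | boxf (h : L = .S4m) (φ : Formula Θ) :
      PropRule L .f (.box φ) [[signed .t φ], [signed .f φ], [signed .F φ]]
  | boxF (φ : Formula Θ) :
      PropRule L .F (.box φ) [[signed .t φ], [signed .f φ], [signed .F φ]]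
  | impT (φ ψ : Formula Θ) : PropRule L .T (.imp φ ψ)
      [[signed .F φ], [signed .t φ, signed .t ψ], [signed .f φ, signed .t ψ],
        [signed .f φ, signed .f ψ], [signed .T ψ]]
  | impt (φ ψ : Formula Θ) : PropRule L .t (.imp φ ψ)
      [[signed .T φ, signed .t ψ], [signed .t φ, signed .t ψ], [signed .f φ, signed .t ψ],
        [signed .f φ, signed .f ψ], [signed .f φ, signed .F ψ]]
  | impf (φ ψ : Formula Θ) : PropRule L .f (.imp φ ψ)
      [[signed .T φ, signed .f ψ], [signed .t φ, signed .f ψ], [signed .t φ, signed .F ψ]]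
  | impF (φ ψ : Formula Θ) : PropRule L .F (.imp φ ψ) [[signed .T φ, signed .F ψ]]

open Entry in
/-- `Expands L θ alts`: some rule is applicable on the branch `θ` and extends it in the ways
listed in `alts`. The rules for `t : ∀ x φ` and `f : ∀ x φ` have two forms: the first use, with a
fresh constant `c`, and the later uses, which keep that `c`. The rule for `F : ∀ x φ` is used only
once on a branch; the rule for `T : ∀ x φ` can be used with all constants. -/
inductive Expands (L : Logic) (θ : Branch Θ) : List (List (Entry Θ)) → Prop
  | prop {l : TV} {φ : Formula Θ} {alts : List (List (Entry Θ))}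
      (h : signed l φ ∈ θ) (hr : PropRule L l φ alts) : Expands L θ alts
  | allT {x : ℕ} {φ : Formula Θ} (c : Θ.Const) (h : signed .T (.all x φ) ∈ θ) :
      Expands L θ [[signed .T (φ.subst₁ x (.const c))]]
  | allF {x : ℕ} {φ : Formula Θ} (c : Θ.Const) (h : signed .F (.all x φ) ∈ θ)
      (hc : Fresh c θ) (hfirst : ∀ d, marked .F x φ d ∉ θ) :
      Expands L θ [[signed .F (φ.subst₁ x (.const c)), marked .F x φ c]]
  | allt {x : ℕ} {φ : Formula Θ} (c c' : Θ.Const) (h : signed .t (.all x φ) ∈ θ)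
      (hc : Fresh c θ) (hne : c' ≠ c) (hfirst : ∀ d, marked .t x φ d ∉ θ) :
      Expands L θ
        [[signed .t (φ.subst₁ x (.const c)), signed .t (φ.subst₁ x (.const c')), marked .t x φ c],
         [signed .t (φ.subst₁ x (.const c)), signed .T (φ.subst₁ x (.const c')), marked .t x φ c]]
  | allt_again {x : ℕ} {φ : Formula Θ} (c c' : Θ.Const) (h : marked .t x φ c ∈ θ) (hne : c' ≠ c) :
      Expands L θ
        [[signed .t (φ.subst₁ x (.const c'))], [signed .T (φ.subst₁ x (.const c'))]]
  | allf {x : ℕ} {φ : Formula Θ} (c c' : Θ.Const) (h : signed .f (.all x φ) ∈ θ)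
      (hc : Fresh c θ) (hne : c' ≠ c) (hfirst : ∀ d, marked .f x φ d ∉ θ) :
      Expands L θ
        [[signed .f (φ.subst₁ x (.const c)), signed .f (φ.subst₁ x (.const c')), marked .f x φ c],
         [signed .f (φ.subst₁ x (.const c)), signed .T (φ.subst₁ x (.const c')), marked .f x φ c],
         [signed .f (φ.subst₁ x (.const c)), signed .t (φ.subst₁ x (.const c')), marked .f x φ c]]
  | allf_again {x : ℕ} {φ : Formula Θ} (c c' : Θ.Const) (h : marked .f x φ c ∈ θ) (hne : c' ≠ c) :
      Expands L θ
        [[signed .f (φ.subst₁ x (.const c'))], [signed .T (φ.subst₁ x (.const c'))],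
         [signed .t (φ.subst₁ x (.const c'))]]

/-- A branch is closed if it contains variants with different signs, or a signed formula whose rule
closes the branch: `t : □ φ` in both logics, and `f : □ φ` in `S5m*`. -/
def BranchClosed (L : Logic) (θ : Branch Θ) : Prop :=
  (∃ l l' φ φ', Entry.signed l φ ∈ θ ∧ Entry.signed l' φ' ∈ θ ∧ φ.Variant φ' ∧ l ≠ l') ∨
  (∃ φ, Entry.signed .t (.box φ) ∈ θ) ∨
  (L = .S5m ∧ ∃ φ, Entry.signed .f (.box φ) ∈ θ)

/-- One step in the construction of a tableau, given as the list of its branches: a rule is applied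
on one of the branches, which is replaced by its extensions. -/
def Step (L : Logic) (𝓕 𝓕' : List (Branch Θ)) : Prop :=
  ∃ (𝓕₁ 𝓕₂ : List (Branch Θ)) (θ : Branch Θ) (alts : List (List (Entry Θ))),
    𝓕 = 𝓕₁ ++ θ :: 𝓕₂ ∧ Expands L θ alts ∧ 𝓕' = 𝓕₁ ++ alts.map (fun e => θ ++ e) ++ 𝓕₂

/-- `𝓕` is a (finite) tableau that starts from the signed formula `l : φ`. -/
def IsTableau (L : Logic) (l : TV) (φ : Formula Θ) (𝓕 : List (Branch Θ)) : Prop :=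
  Relation.ReflTransGen (Step L) [[Entry.signed l φ]] 𝓕

/-- A formula over `Θ` is provable by tableaux if for both undesignated signs there is a closed
tableau that starts from the signed formula; the tableaux use the signature obtained from `Θ` by
adding denumerably many new constants. -/
def TabProvable (L : Logic) (φ : Formula Θ) : Prop :=
  ∀ l ∈ ({TV.F, TV.f} : Set TV), ∃ 𝓕 : List (Branch (Θ.extend ℕ)),
    IsTableau L l (φ.lift ℕ) 𝓕 ∧ ∀ θ ∈ 𝓕, BranchClosed L θ

/-- `φ` is provable by tableaux from `γ₁, …, γₙ`. -/
def TabProvableFrom (L : Logic) (Γ : List (Formula Θ)) (φ : Formula Θ) : Prop :=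
  TabProvable L (Formula.impChain Γ φ)

end Tableaux

end Ivlev

/-!
Both directions compare a chain of implications with its value under a valuation: for sentences,
`Γ` entails `φ` exactly if the chain `γ₁ → … → γₙ → φ` takes a designated value everywhere
(`semCons_iff`), so it suffices to show that a sentence is valid exactly if tableaux refute both
undesignated signs.

*Soundness.* If a valuation gives a sentence the value `l`, then every tableau that starts from the
sentence signed with `l` has a branch all of whose entries hold, under some interpretation of the
constants of the tableau by diagram constants (`IsTableau.exists_holds`). A fresh constant can be
reinterpreted as a witness for the value of a quantified formula, which is attained because it is a
minimum. Such a branch is not closed, since valuations respect variance (`not_branchClosed`).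

*Completeness.* If no closed tableau starts from `l : φ`, then that branch can be extended for ever
without becoming closable, and a fair strategy produces a Hintikka set `H` (`exists_isHintikka`).
Only countably many constants matter, those of `φ` and the new ones, and they form the domain. A
valuation is defined by recursion on formulas (`canonVal`): `¬` and `∀` are deterministic, and the
free choices at `□` and `→` are made as `H` prescribes. What `H` prescribes is looked up modulo
variance of the immediate subformulas. Thus variants have the same value (`canonVal_variant`), the
value of every formula signed in `H` is its sign (`IsHintikka.canonVal_eq`), and the values of `□ φ`
and `φ → ψ` fit those of their parts, because the rules have been applied to the formulas in `H`
(`IsHintikka.canonVal_box`, `IsHintikka.canonVal_imp`).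
-/

namespace Ivlev

variable {Θ : Signature.{u, v}}

/-! ### Substitution and renaming of constants -/

/-- Replacing the variables of a term. -/
def Term.subst {K : Type*} (σ : ℕ → Term K) : Term K → Term K
  | .var n => σ n
  | .const c => .const c

theorem Term.map_subst {K K' : Type*} (g : K → K') (σ : ℕ → Term K) (τ : Term K) :
    (τ.subst σ).map g = (τ.map g).subst fun n => (σ n).map g := by
  cases τ <;> rfl

/-- A substitution that replaces each variable by a constant or leaves it alone. No variable is ever
captured by such a substitution. -/
def IsGrounding {K : Type*} (σ : ℕ → Term K) : Prop :=
  ∀ n, σ n = Term.var n ∨ ∃ c, σ n = Term.const c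

theorem IsGrounding.update_var {K : Type*} {σ : ℕ → Term K} (hσ : IsGrounding σ) (x : ℕ) :
    IsGrounding (Function.update σ x (Term.var x)) := by
  intro n
  by_cases h : n = x
  · subst h; simp
  · simpa [Function.update_of_ne h] using hσ n

theorem IsGrounding.update_const {K : Type*} {σ : ℕ → Term K} (hσ : IsGrounding σ) (x : ℕ) (c : K) :
    IsGrounding (Function.update σ x (Term.const c)) := by
  intro n
  by_cases h : n = x
  · subst h; simp
  · simpa [Function.update_of_ne h] using hσ n

theorem isGrounding_var {K : Type*} : IsGrounding (Term.var : ℕ → Term K) := fun _ => .inl rfl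

theorem isGrounding_const {K : Type*} (ρ : ℕ → K) : IsGrounding fun n => Term.const (ρ n) :=
  fun n => .inr ⟨ρ n, rfl⟩

namespace Formula

theorem subst_atom (σ : ℕ → Term Θ.Const) (p : Θ.Pred) (τ : Fin (Θ.arity p) → Term Θ.Const) :
    (atom p τ).subst σ = atom p fun i => (τ i).subst σ := by
  simp only [subst]
  congr 1
  funext i
  cases τ i <;> rfl

theorem subst_congr {φ : Formula Θ} {σ σ' : ℕ → Term Θ.Const}
    (h : ∀ n ∈ φ.freeVars, σ n = σ' n) : φ.subst σ = φ.subst σ' := by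
  induction φ generalizing σ σ' with
  | atom p τ =>
    simp only [subst_atom, atom.injEq, heq_eq_eq, true_and]
    funext i
    cases hi : τ i with
    | var n => exact h n ⟨i, hi⟩
    | const c => rfl
  | neg φ ih => simp only [subst, ih h]
  | box φ ih => simp only [subst, ih h]
  | imp φ ψ ih ih' =>
    simp only [subst, ih fun n hn => h n (.inl hn), ih' fun n hn => h n (.inr hn)]
  | all x φ ih =>
    simp only [subst]
    rw [ih]
    intro n hn
    by_cases hx : n = x
    · simp [hx]
    · simpa [Function.update_of_ne hx] using h n ⟨hn, hx⟩

theorem subst_var (φ : Formula Θ) : φ.subst Term.var = φ := by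
  induction φ with
  | atom p τ =>
    rw [subst_atom]
    congr 1
    funext i
    cases τ i <;> rfl
  | neg φ ih => simp only [subst, ih]
  | box φ ih => simp only [subst, ih]
  | imp φ ψ ih ih' => simp only [subst, ih, ih']
  | all x φ ih => simp only [subst, Function.update_eq_self, ih]

theorem Closed.subst_eq {φ : Formula Θ} (h : φ.Closed) (σ : ℕ → Term Θ.Const) :
    φ.subst σ = φ := by
  conv_rhs => rw [← subst_var φ]
  refine subst_congr fun n hn => ?_
  rw [h] at hn
  exact hn.elim

/-- Substitutions compose as soon as the first one is grounding. -/
theorem subst_subst {σ : ℕ → Term Θ.Const} (hσ : IsGrounding σ) (σ' : ℕ → Term Θ.Const)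
    (φ : Formula Θ) : (φ.subst σ).subst σ' = φ.subst fun n => (σ n).subst σ' := by
  induction φ generalizing σ σ' with
  | atom p τ =>
    simp only [subst_atom]
    congr 1
    funext i
    cases τ i <;> rfl
  | neg φ ih => simp only [subst, ih hσ]
  | box φ ih => simp only [subst, ih hσ]
  | imp φ ψ ih ih' => simp only [subst, ih hσ, ih' hσ]
  | all x φ ih =>
    simp only [subst]
    rw [ih (hσ.update_var x)]
    congr 2
    funext n
    by_cases hx : n = x
    · subst hx; simp [Term.subst]
    · rcases hσ n with h | ⟨c, h⟩ <;> simp [Function.update_of_ne hx, h, Term.subst]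

/-- Renaming a variable `x` to one that is free for `x` and then substituting amounts to a single
substitution. -/
theorem subst₁_var_subst {x y : ℕ} {φ : Formula Θ} (hf : φ.FreeFor y x) (σ : ℕ → Term Θ.Const) :
    (φ.subst₁ x (Term.var y)).subst σ = φ.subst (Function.update σ x (σ y)) := by
  induction φ generalizing σ with
  | atom p τ =>
    simp only [subst₁, subst_atom]
    congr 1
    funext i
    cases τ i with
    | const c => rfl
    | var n =>
      by_cases hx : n = x
      · subst hx; simp [Term.subst]
      · simp [Term.subst, Function.update_of_ne hx]
  | neg φ ih => exact congrArg neg (ih hf σ)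
  | box φ ih => exact congrArg box (ih hf σ)
  | imp φ ψ ih ih' => exact congrArg₂ imp (ih hf.1 σ) (ih' hf.2 σ)
  | all z φ ih =>
    by_cases hx : x ∈ (all z φ).freeVars
    · obtain ⟨hzy, hf⟩ := hf.resolve_left (not_not_intro hx)
      have hxz : z ≠ x := fun h => hx.2 h.symm
      have := ih hf (Function.update σ z (Term.var z))
      rw [Function.update_of_ne hzy.symm, Function.update_comm hxz] at this
      refine Eq.trans ?_ (congrArg (all z) this)
      simp only [subst₁, subst]
      rw [Function.update_comm hxz.symm, Function.update_eq_self]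
    · have h1 : (all z φ).subst₁ x (Term.var y) = all z φ := by
        conv_rhs => rw [← subst_var (all z φ)]
        refine subst_congr fun n hn => Function.update_of_ne ?_ _ _
        rintro rfl
        exact hx hn
      rw [h1]
      refine subst_congr fun n hn => (Function.update_of_ne ?_ _ _).symm
      rintro rfl
      exact hx hn

theorem freeVars_subst {σ : ℕ → Term Θ.Const} (hσ : IsGrounding σ) (φ : Formula Θ) :
    (φ.subst σ).freeVars = {n ∈ φ.freeVars | σ n = Term.var n} := by
  induction φ generalizing σ with
  | atom p τ =>
    rw [subst_atom]
    ext n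
    simp only [freeVars, Set.mem_ofPred_eq]
    constructor
    · rintro ⟨i, hi⟩
      cases h : τ i with
      | const c => simp [h, Term.subst] at hi
      | var m =>
        simp only [h, Term.subst] at hi
        rcases hσ m with h' | ⟨c, h'⟩
        · obtain rfl : m = n := by simpa [h'] using hi
          exact ⟨⟨i, h⟩, h'⟩
        · simp [h'] at hi
    · rintro ⟨⟨i, hi⟩, h⟩
      exact ⟨i, by rw [hi]; exact h⟩
  | neg φ ih => exact ih hσ
  | box φ ih => exact ih hσ
  | imp φ ψ ih ih' =>
    simp only [subst, freeVars, ih hσ, ih' hσ]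
    ext n
    simp only [Set.mem_union, Set.mem_ofPred_eq]
    tauto
  | all x φ ih =>
    simp only [subst, freeVars, ih (hσ.update_var x)]
    ext n
    by_cases hx : n = x
    · simp [hx]
    · simp [hx]

theorem isGrounding_subst₁ (x : ℕ) (c : Θ.Const) :
    IsGrounding (Function.update Term.var x (Term.const c)) :=
  isGrounding_var.update_const x c

theorem Closed.subst₁_const {x : ℕ} {φ : Formula Θ} (h : (all x φ).Closed) (c : Θ.Const) :
    (φ.subst₁ x (.const c)).Closed := by
  rw [Closed, subst₁, freeVars_subst (isGrounding_subst₁ x c), Set.eq_empty_iff_forall_notMem]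
  rintro n ⟨hn, hc⟩
  by_cases hx : n = x
  · simp [hx] at hc
  · have : n ∈ (all x φ).freeVars := ⟨hn, hx⟩
    rw [h] at this
    exact this

theorem FreeFor.subst {σ : ℕ → Term Θ.Const} (hσ : IsGrounding σ) {x y : ℕ} {φ : Formula Θ}
    (h : φ.FreeFor y x) : (φ.subst σ).FreeFor y x := by
  induction φ generalizing σ with
  | atom p τ => trivial
  | neg φ ih => exact ih hσ h
  | box φ ih => exact ih hσ h
  | imp φ ψ ih ih' => exact ⟨ih hσ h.1, ih' hσ h.2⟩
  | all z φ ih =>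
    refine h.imp (fun h h' => h ?_) fun h => ⟨h.1, ih (hσ.update_var z) h.2⟩
    change x ∈ ((all z φ).subst σ).freeVars at h'
    rw [freeVars_subst hσ] at h'
    exact h'.1

/-- Variants are stable under grounding substitutions. -/
theorem Variant.subst {σ : ℕ → Term Θ.Const} (hσ : IsGrounding σ) {φ ψ : Formula Θ}
    (h : φ.Variant ψ) : (φ.subst σ).Variant (ψ.subst σ) := by
  have void {x : ℕ} {φ : Formula Θ} (h : x ∉ φ.freeVars) {σ : ℕ → Term Θ.Const}
      (hσ : IsGrounding σ) : φ.subst (Function.update σ x (Term.var x)) = φ.subst σ ∧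
        x ∉ (φ.subst σ).freeVars := by
    refine ⟨subst_congr fun n hn => Function.update_of_ne ?_ _ _, ?_⟩
    · rintro rfl; exact h hn
    · rw [freeVars_subst hσ]; exact fun h' => h h'.1
  induction h generalizing σ with
  | voidAll x φ h =>
    obtain ⟨h1, h2⟩ := void h hσ
    simp only [Formula.subst, h1]
    exact .voidAll x _ h2
  | voidEx x φ h =>
    obtain ⟨h1, h2⟩ := void h hσ
    simp only [Formula.subst, h1]
    exact .voidEx x _ h2
  | rename x y φ hy hf =>
    have hσx := hσ.update_var x
    have key : (φ.subst₁ x (Term.var y)).subst (Function.update σ y (Term.var y)) =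
        (φ.subst (Function.update σ x (Term.var x))).subst₁ x (Term.var y) := by
      rw [subst₁_var_subst hf, subst₁, subst_subst hσx]
      refine subst_congr fun n hn => ?_
      have hny : n ≠ y := by rintro rfl; exact hy hn
      by_cases hx : n = x
      · subst hx; simp [Term.subst]
      · rcases hσ n with h | ⟨c, h⟩ <;>
          simp [Function.update_of_ne hx, Function.update_of_ne hny, h, Term.subst]
    simp only [Formula.subst, key]
    refine .rename x y _ ?_ (hf.subst hσx)
    rw [freeVars_subst hσx]
    exact fun h => hy h.1
  | neg _ ih => exact .neg (ih hσ)
  | box _ ih => exact .box (ih hσ)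
  | imp _ _ ih ih' => exact .imp (ih hσ) (ih' hσ)
  | all x _ ih => exact .all x (ih (hσ.update_var x))
  | refl φ => exact .refl _
  | symm _ ih => exact (ih hσ).symm
  | trans _ _ ih ih' => exact (ih hσ).trans (ih' hσ)

/-- Renaming the constants of a formula, between two extensions of the same signature. -/
def mapConst {D : Type*} {D' : Type*} (g : (Θ.extend D).Const → (Θ.extend D').Const) :
    Formula (Θ.extend D) → Formula (Θ.extend D')
  | .atom p τ => .atom (Θ := Θ.extend D') p fun i => (τ i).map g
  | .neg φ => .neg (φ.mapConst g)
  | .box φ => .box (φ.mapConst g)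
  | .imp φ ψ => .imp (φ.mapConst g) (ψ.mapConst g)
  | .all x φ => .all x (φ.mapConst g)

section mapConst

variable {D : Type*} {D' : Type*} (g : (Θ.extend D).Const → (Θ.extend D').Const)

theorem freeVars_mapConst (φ : Formula (Θ.extend D)) : (φ.mapConst g).freeVars = φ.freeVars := by
  induction φ with
  | atom p τ =>
    ext n
    refine exists_congr fun i => ?_
    cases h : τ i <;> simp [h, Term.map]
  | neg φ ih => exact ih
  | box φ ih => exact ih
  | imp φ ψ ih ih' => simp only [mapConst, freeVars, ih, ih']
  | all x φ ih => simp only [mapConst, freeVars, ih]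

variable {g} in
theorem Closed.mapConst {φ : Formula (Θ.extend D)} (h : φ.Closed) : (φ.mapConst g).Closed := by
  rw [Closed, freeVars_mapConst]; exact h

theorem mapConst_subst (σ : ℕ → Term (Θ.extend D).Const) (φ : Formula (Θ.extend D)) :
    (φ.subst σ).mapConst g = (φ.mapConst g).subst fun n => (σ n).map g := by
  induction φ generalizing σ with
  | atom p τ =>
    refine (congrArg (Formula.mapConst g) (subst_atom σ p τ)).trans
      (Eq.trans ?_ (subst_atom (Θ := Θ.extend D') _ p _).symm)
    refine congrArg (atom (Θ := Θ.extend D') p) (funext fun i => ?_)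
    exact Term.map_subst g σ (τ i)
  | neg φ ih => simp only [mapConst, subst, ih]
  | box φ ih => simp only [mapConst, subst, ih]
  | imp φ ψ ih ih' => simp only [mapConst, subst, ih, ih']
  | all x φ ih =>
    simp only [mapConst, subst, ih]
    congr 2
    funext n
    by_cases hx : n = x
    · subst hx; simp [Term.map]
    · simp [Function.update_of_ne hx]

theorem mapConst_subst₁ (x : ℕ) (τ : Term (Θ.extend D).Const) (φ : Formula (Θ.extend D)) :
    (φ.subst₁ x τ).mapConst g = (φ.mapConst g).subst₁ x (τ.map g) := by
  rw [subst₁, subst₁, mapConst_subst]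
  congr 1
  funext n
  by_cases hx : n = x
  · subst hx; simp
  · simp [Function.update_of_ne hx, Term.map]

variable {g} in
theorem FreeFor.mapConst {x y : ℕ} {φ : Formula (Θ.extend D)} (h : φ.FreeFor y x) :
    (φ.mapConst g).FreeFor y x := by
  induction φ with
  | atom p τ => trivial
  | neg φ ih => exact ih h
  | box φ ih => exact ih h
  | imp φ ψ ih ih' => exact ⟨ih h.1, ih' h.2⟩
  | all z φ ih =>
    refine h.imp (fun h h' => h ?_) fun h => ⟨h.1, ih h.2⟩
    rwa [← freeVars_mapConst g]

variable {g} in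
/-- Variants are stable under renaming of constants. -/
theorem Variant.mapConst {φ ψ : Formula (Θ.extend D)} (h : φ.Variant ψ) :
    (φ.mapConst g).Variant (ψ.mapConst g) := by
  induction h with
  | voidAll x φ h => exact .voidAll x _ (by rwa [freeVars_mapConst])
  | voidEx x φ h => exact .voidEx x _ (by rwa [freeVars_mapConst])
  | rename x y φ hy hf =>
    simp only [Formula.mapConst, mapConst_subst₁]
    exact .rename x y _ (by rwa [freeVars_mapConst]) hf.mapConst
  | neg _ ih => exact .neg ih
  | box _ ih => exact .box ih
  | imp _ _ ih ih' => exact .imp ih ih'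
  | all x _ ih => exact .all x ih
  | refl φ => exact .refl _
  | symm _ ih => exact ih.symm
  | trans _ _ ih ih' => exact ih.trans ih'

variable {g} in
theorem mapConst_congr {g' : (Θ.extend D).Const → (Θ.extend D').Const} {φ : Formula (Θ.extend D)}
    (h : ∀ c ∈ φ.consts, g c = g' c) : φ.mapConst g = φ.mapConst g' := by
  induction φ with
  | atom p τ =>
    simp only [mapConst]
    congr 1
    funext i
    cases hi : τ i with
    | var n => rfl
    | const c => exact congrArg Term.const (h c ⟨i, hi⟩)
  | neg φ ih => simp only [mapConst, ih h]
  | box φ ih => simp only [mapConst, ih h]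
  | imp φ ψ ih ih' =>
    simp only [mapConst, ih fun n hn => h n (.inl hn), ih' fun n hn => h n (.inr hn)]
  | all x φ ih => simp only [mapConst, ih h]

variable {g} in
theorem mapConst_lift {φ : Formula Θ} (h : ∀ c ∈ φ.consts, g (.inl c) = .inl c) :
    (φ.lift D).mapConst g = φ.lift D' := by
  induction φ with
  | atom p τ =>
    simp only [mapConst, lift]
    congr 1
    funext i
    cases hi : τ i with
    | var n => rfl
    | const c => exact congrArg Term.const (h c ⟨i, hi⟩)
  | neg φ ih => simp only [mapConst, lift, ih h]
  | box φ ih => simp only [mapConst, lift, ih h]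
  | imp φ ψ ih ih' =>
    simp only [mapConst, lift, ih fun n hn => h n (.inl hn), ih' fun n hn => h n (.inr hn)]
  | all x φ ih => simp only [mapConst, lift, ih h]

end mapConst

theorem freeVars_lift (D : Type*) (φ : Formula Θ) : (φ.lift D).freeVars = φ.freeVars := by
  induction φ with
  | atom p τ =>
    ext n
    refine exists_congr fun i => ?_
    cases h : τ i <;> simp [h, Term.map]
  | neg φ ih => exact ih
  | box φ ih => exact ih
  | imp φ ψ ih ih' => simp only [lift, freeVars, ih, ih']
  | all x φ ih => simp only [lift, freeVars, ih]

theorem Closed.lift {φ : Formula Θ} (h : φ.Closed) (D : Type*) : (φ.lift D).Closed := by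
  rw [Closed, freeVars_lift]; exact h

theorem finite_consts (φ : Formula Θ) : φ.consts.Finite := by
  induction φ with
  | atom p τ =>
    refine ((Set.finite_range τ).preimage (f := Term.const)
      fun a _ b _ h => Term.const.inj h).subset ?_
    rintro c ⟨i, hi⟩
    exact ⟨i, hi⟩
  | neg φ ih => exact ih
  | box φ ih => exact ih
  | imp φ ψ ih ih' => exact ih.union ih'
  | all x φ ih => exact ih

theorem closed_impChain {Γ : List (Formula Θ)} {φ : Formula Θ} (hΓ : ∀ γ ∈ Γ, γ.Closed)
    (hφ : φ.Closed) : (impChain Γ φ).Closed := by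
  induction Γ with
  | nil => exact hφ
  | cons γ Γ ih =>
    simp only [List.mem_cons, forall_eq_or_imp] at hΓ
    have h1 : γ.freeVars = ∅ := hΓ.1
    have h2 : (impChain Γ φ).freeVars = ∅ := ih hΓ.2
    change γ.freeVars ∪ (impChain Γ φ).freeVars = ∅
    rw [h1, h2, Set.union_empty]

end Formula

/-! ### The multioperators -/

theorem T_mem_allOp {X : Set TV} : .T ∈ allOp X ↔ ∀ m ∈ X, m = .T := by
  unfold allOp
  constructor
  · intro h m hm
    cases m <;> simp_all <;> split_ifs at h <;> simp at h
  · intro h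
    have h1 : TV.F ∉ X := fun h' => by simpa using h _ h'
    have h2 : TV.f ∉ X := fun h' => by simpa using h _ h'
    have h3 : TV.t ∉ X := fun h' => by simpa using h _ h'
    simp [h1, h2, h3]

theorem F_mem_allOp {X : Set TV} : .F ∈ allOp X ↔ .F ∈ X := by
  unfold allOp
  split_ifs <;> simp_all

theorem t_mem_allOp {X : Set TV} : .t ∈ allOp X ↔ .t ∈ X ∧ ∀ m ∈ X, m = .t ∨ m = .T := by
  unfold allOp
  constructor
  · intro h
    refine ⟨by by_contra h'; simp [h'] at h; split_ifs at h <;> simp at h, fun m hm => ?_⟩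
    cases m <;> simp_all
    split_ifs at h <;> simp at h
  · rintro ⟨h, h'⟩
    have h1 : TV.F ∉ X := fun h'' => by simpa using h' _ h''
    have h2 : TV.f ∉ X := fun h'' => by simpa using h' _ h''
    simp [h1, h2, h]

theorem f_mem_allOp {X : Set TV} :
    .f ∈ allOp X ↔ .f ∈ X ∧ ∀ m ∈ X, m = .f ∨ m = .T ∨ m = .t := by
  unfold allOp
  constructor
  · intro h
    refine ⟨by by_contra h'; simp [h'] at h; split_ifs at h <;> simp at h, fun m hm => ?_⟩
    cases m <;> simp_all
  · rintro ⟨h, h'⟩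
    have h1 : TV.F ∉ X := fun h'' => by simpa using h' _ h''
    simp [h1, h]

theorem exists_allOp_eq (X : Set TV) : ∃ l, allOp X = {l} := by
  unfold allOp
  split_ifs <;> exact ⟨_, rfl⟩

/-- The value of the (deterministic) multioperator of the universal quantifier. -/
noncomputable def allVal (X : Set TV) : TV := (exists_allOp_eq X).choose

theorem allOp_eq (X : Set TV) : allOp X = {allVal X} := (exists_allOp_eq X).choose_spec

theorem allVal_eq {X : Set TV} {l : TV} (h : l ∈ allOp X) : allVal X = l := by
  rw [allOp_eq] at h; exact h.symm

theorem allVal_singleton (l : TV) : allVal {l} = l := by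
  apply allVal_eq
  cases l <;> simp [T_mem_allOp, t_mem_allOp, f_mem_allOp, F_mem_allOp]

/-- The value of the (deterministic) multioperator of negation. -/
def negVal : TV → TV
  | .T => .F
  | .t => .f
  | .f => .t
  | .F => .T

theorem negOp_eq (a : TV) : negOp a = {negVal a} := by cases a <;> rfl

theorem negVal_negVal (a : TV) : negVal (negVal a) = a := by cases a <;> rfl

theorem impOp_nonempty (a b : TV) : (impOp a b).Nonempty := by
  cases a <;> cases b <;> simp [impOp]

theorem boxOp_nonempty (L : Logic) (a : TV) : (boxOp L a).Nonempty := by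
  cases L <;> cases a <;> simp [boxOp]

theorem undesignated_imp {a b l : TV} (h : l ∈ impOp a b) (hl : l ∉ Designated) :
    a ∈ Designated ∧ b ∉ Designated := by
  cases a <;> cases b <;> simp_all [impOp, Designated]

theorem mem_undesignated {l : TV} : l ∉ Designated ↔ l ∈ ({TV.F, TV.f} : Set TV) := by
  cases l <;> simp [Designated]

theorem designated_of_imp {a b l : TV} (h : l ∈ impOp a b) (ha : a ∈ Designated)
    (hl : l ∈ Designated) : b ∈ Designated := by
  cases a <;> cases b <;> simp_all [impOp, Designated]

/-! ### Soundness -/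

theorem mem_boxOp {L : Logic} {a l : TV} (h : l ∈ boxOp L a) :
    (l = .T ∧ a = .T) ∨ ((l = .F ∨ l = .f ∧ L = .S4m) ∧ (a = .t ∨ a = .f ∨ a = .F)) := by
  cases L <;> cases a <;> simpa [boxOp, or_comm] using h

theorem T_mem_impOp {a b : TV} (h : .T ∈ impOp a b) :
    a = .F ∨ a = .t ∧ b = .t ∨ a = .f ∧ b = .t ∨ a = .f ∧ b = .f ∨ b = .T := by
  cases a <;> cases b <;> simp [impOp] at h ⊢

theorem t_mem_impOp {a b : TV} (h : .t ∈ impOp a b) : a = .T ∧ b = .t ∨ a = .t ∧ b = .t ∨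
    a = .f ∧ b = .t ∨ a = .f ∧ b = .f ∨ a = .f ∧ b = .F := by
  cases a <;> cases b <;> simp [impOp] at h ⊢

theorem f_mem_impOp {a b : TV} (h : .f ∈ impOp a b) :
    a = .T ∧ b = .f ∨ a = .t ∧ b = .f ∨ a = .t ∧ b = .F := by
  cases a <;> cases b <;> simp [impOp] at h ⊢

theorem F_mem_impOp {a b : TV} (h : .F ∈ impOp a b) : a = .T ∧ b = .F := by
  cases a <;> cases b <;> simp [impOp] at h ⊢

/-- The formula of an entry is closed. -/
def Entry.Closed : Entry Θ → Prop
  | .signed _ φ => φ.Closed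
  | .marked _ x φ _ => (Formula.all x φ).Closed

theorem Expands.closed {L : Logic} {θ : Branch Θ} {alts : List (List (Entry Θ))}
    (h : Expands L θ alts) (hθ : ∀ e ∈ θ, e.Closed) : ∀ alt ∈ alts, ∀ e ∈ alt, e.Closed := by
  cases h with
  | prop h hr =>
    have := hθ _ h
    cases hr <;> simp_all [Entry.Closed, Formula.Closed, Formula.freeVars]
  | allT c h => simpa [Entry.Closed] using Formula.Closed.subst₁_const (hθ _ h) c
  | allF c h | allt c c' h | allt_again c c' h | allf c c' h | allf_again c c' h =>
    have h1 := hθ _ h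
    simp_all [Entry.Closed, Formula.Closed.subst₁_const h1]

section Soundness

variable {L : Logic} {A : ModalStructure.{u, v, w} Θ} {val : Formula A.diagram → TV}

/-- What an entry says about a valuation, when the constants of the tableau are interpreted by `g`;
a mark repeats what the marked quantified formula says. -/
def Entry.Holds (val : Formula A.diagram → TV) (g : (Θ.extend ℕ).Const → A.diagram.Const) :
    Entry (Θ.extend ℕ) → Prop
  | .signed l φ => val (φ.mapConst g) = l
  | .marked l x φ _ => val ((Formula.all x φ).mapConst g) = l

theorem Entry.Holds.congr {g g' : (Θ.extend ℕ).Const → A.diagram.Const} {e : Entry (Θ.extend ℕ)}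
    (he : e.Holds val g) (h : ∀ c ∈ e.consts, g c = g' c) : e.Holds val g' := by
  cases e with
  | signed l φ => rwa [Holds, ← Formula.mapConst_congr h]
  | marked l x φ c =>
    rwa [Holds, ← Formula.mapConst_congr (φ := .all x φ) fun d hd => h d (.inr hd)]

open Classical in
theorem holds_update {g : (Θ.extend ℕ).Const → A.diagram.Const} {θ : Branch (Θ.extend ℕ)}
    (h : ∀ e ∈ θ, e.Holds val g) {c : (Θ.extend ℕ).Const} (hc : Fresh c θ) (d : A.diagram.Const) :
    ∀ e ∈ θ, e.Holds val (Function.update g c d) := by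
  refine fun e he => (h e he).congr fun c' hc' => (Function.update_of_ne ?_ _ _).symm
  rintro rfl
  exact hc e he hc'

theorem PropRule.sound (hv : A.IsValuation L val) {l : TV} {φ : Formula (Θ.extend ℕ)}
    {alts : List (List (Entry (Θ.extend ℕ)))} (hr : PropRule L l φ alts) (hφ : φ.Closed)
    {g : (Θ.extend ℕ).Const → A.diagram.Const} (hl : val (φ.mapConst g) = l) :
    ∃ alt ∈ alts, ∀ e ∈ alt, e.Holds val g := by
  cases hr with
  | negT φ | negt φ | negf φ | negF φ =>
    have h := hv.neg (φ.mapConst g) (Formula.Closed.mapConst (φ := φ) hφ)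
    rw [show val (.neg (φ.mapConst g)) = _ from hl, negOp_eq, Set.mem_singleton_iff] at h
    have h' := congrArg negVal h
    rw [negVal_negVal] at h'
    simpa [Entry.Holds, negVal] using h'.symm
  | boxT φ | boxf hL φ | boxF φ =>
    have h := hv.box (φ.mapConst g) (Formula.Closed.mapConst (φ := φ) hφ)
    rw [show val (.box (φ.mapConst g)) = _ from hl] at h
    have h' := mem_boxOp h
    simp only [reduceCtorEq, true_and, false_and, false_or, or_false] at h'
    simp [Entry.Holds, h']
  | impT φ ψ | impt φ ψ | impf φ ψ | impF φ ψ =>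
    have hφ' := Set.union_empty_iff.1 hφ
    have h := hv.imp (φ.mapConst g) (ψ.mapConst g) (Formula.Closed.mapConst (φ := φ) hφ'.1)
      (Formula.Closed.mapConst (φ := ψ) hφ'.2)
    rw [show val (.imp (φ.mapConst g) (ψ.mapConst g)) = _ from hl] at h
    simp only [List.mem_cons, List.not_mem_nil, or_false, exists_eq_or_imp, exists_eq_left,
      forall_eq_or_imp, forall_eq, Entry.Holds]
    first
      | exact T_mem_impOp h
      | exact t_mem_impOp h
      | exact f_mem_impOp h
      | exact F_mem_impOp h

/-- The rules are sound: if all entries of a branch hold, then the constants can be reinterpreted so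
that all entries of one of the alternatives hold too. -/
theorem Expands.sound (hv : A.IsValuation L val) {θ : Branch (Θ.extend ℕ)}
    {alts : List (List (Entry (Θ.extend ℕ)))} (hE : Expands L θ alts) (hcl : ∀ e ∈ θ, e.Closed)
    {g : (Θ.extend ℕ).Const → A.diagram.Const} (hg : ∀ e ∈ θ, e.Holds val g) :
    ∃ alt ∈ alts, ∃ g' : (Θ.extend ℕ).Const → A.diagram.Const,
      ∀ e ∈ θ ++ alt, e.Holds val g' := by
  classical
  -- A fresh constant can be made to name any given object without affecting the branch.
  have fresh {l : TV} {x : ℕ} {φ : Formula (Θ.extend ℕ)} {c : (Θ.extend ℕ).Const}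
      (h : Entry.signed l (.all x φ) ∈ θ) (hc : Fresh c θ) {d : A.diagram.Const} {l' : TV}
      (hd : l' = val ((φ.mapConst g).subst₁ x (.const d))) :
      ∃ g' : (Θ.extend ℕ).Const → A.diagram.Const, (∀ e ∈ θ, e.Holds val g') ∧
        val ((Formula.all x φ).mapConst g') = l ∧
        val ((φ.subst₁ x (.const c)).mapConst g') = l' := by
    refine ⟨Function.update g c d, holds_update hg hc d, holds_update hg hc d _ h, ?_⟩
    have h1 : φ.mapConst (Function.update g c d) = φ.mapConst g :=
      Formula.mapConst_congr fun c' hc' => Function.update_of_ne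
        (by rintro rfl; exact hc _ h hc') _ _
    rw [Formula.mapConst_subst₁, h1, hd, Term.map, Function.update_self]
  -- The value of a quantified formula is a minimum to which every instance contributes.
  have values {x : ℕ} {φ : Formula (Θ.extend ℕ)} {l : TV} (h : (Formula.all x φ).Closed)
      {g' : (Θ.extend ℕ).Const → A.diagram.Const}
      (hl : val ((Formula.all x φ).mapConst g') = l) (c : (Θ.extend ℕ).Const) :
      l ∈ allOp {l | ∃ c : A.diagram.Const, l = val ((φ.mapConst g').subst₁ x (.const c))} ∧
      val ((φ.subst₁ x (.const c)).mapConst g') ∈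
        {l | ∃ c : A.diagram.Const, l = val ((φ.mapConst g').subst₁ x (.const c))} :=
    ⟨hl ▸ hv.all x (φ.mapConst g') (h.mapConst (g := g')), g' c,
      by rw [Formula.mapConst_subst₁]; rfl⟩
  cases hE with
  | prop h hr =>
    obtain ⟨alt, halt, h'⟩ := hr.sound hv (hcl _ h) (hg _ h)
    exact ⟨alt, halt, g, fun e he => (List.mem_append.1 he).elim (hg e) (h' e)⟩
  | allT c h =>
    obtain ⟨h1, h2⟩ := values (hcl _ h) (hg _ h) c
    have := T_mem_allOp.1 h1 _ h2
    exact ⟨_, List.mem_singleton_self _, g, by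
      simpa [or_imp, forall_and, Entry.Holds, this] using hg⟩
  | @allF x φ c h hc _ =>
    obtain ⟨h1, -⟩ := values (hcl _ h) (hg _ h) c
    obtain ⟨d, hd⟩ := F_mem_allOp.1 h1
    obtain ⟨g', h1, h2, h3⟩ := fresh h hc hd
    exact ⟨_, List.mem_singleton_self _, g', by
      simpa [or_imp, forall_and, Entry.Holds, h3, h2] using h1⟩
  | @allt x φ c c' h hc _ _ =>
    obtain ⟨h1, -⟩ := values (hcl _ h) (hg _ h) c
    obtain ⟨d, hd⟩ := (t_mem_allOp.1 h1).1
    obtain ⟨g', h1, h2, h3⟩ := fresh h hc hd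
    obtain ⟨h4, h5⟩ := values (hcl _ h) h2 c'
    have h6 := (t_mem_allOp.1 h4).2 _ h5
    simp only [List.mem_append, or_imp, forall_and, List.mem_cons, List.not_mem_nil, or_false,
      exists_eq_or_imp, exists_eq_left, forall_eq, Entry.Holds]
    rcases h6 with h6 | h6
    · exact .inl ⟨g', h1, h3, h6, h2⟩
    · exact .inr ⟨g', h1, h3, h6, h2⟩
  | @allt_again x φ c c' h _ =>
    obtain ⟨h4, h5⟩ := values (hcl _ h) (hg _ h) c'
    have h6 := (t_mem_allOp.1 h4).2 _ h5
    simp only [List.mem_append, or_imp, forall_and, List.mem_cons, List.not_mem_nil, or_false,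
      exists_eq_or_imp, exists_eq_left, forall_eq, Entry.Holds]
    rcases h6 with h6 | h6
    · exact .inl ⟨g, hg, h6⟩
    · exact .inr ⟨g, hg, h6⟩
  | @allf x φ c c' h hc _ _ =>
    obtain ⟨h1, -⟩ := values (hcl _ h) (hg _ h) c
    obtain ⟨d, hd⟩ := (f_mem_allOp.1 h1).1
    obtain ⟨g', h1, h2, h3⟩ := fresh h hc hd
    obtain ⟨h4, h5⟩ := values (hcl _ h) h2 c'
    have h6 := (f_mem_allOp.1 h4).2 _ h5
    simp only [List.mem_append, or_imp, forall_and, List.mem_cons, List.not_mem_nil, or_false,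
      exists_eq_or_imp, exists_eq_left, forall_eq, Entry.Holds]
    rcases h6 with h6 | h6 | h6
    · exact .inl ⟨g', h1, h3, h6, h2⟩
    · exact .inr (.inl ⟨g', h1, h3, h6, h2⟩)
    · exact .inr (.inr ⟨g', h1, h3, h6, h2⟩)
  | @allf_again x φ c c' h _ =>
    obtain ⟨h4, h5⟩ := values (hcl _ h) (hg _ h) c'
    have h6 := (f_mem_allOp.1 h4).2 _ h5
    simp only [List.mem_append, or_imp, forall_and, List.mem_cons, List.not_mem_nil, or_false,
      exists_eq_or_imp, exists_eq_left, forall_eq, Entry.Holds]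
    rcases h6 with h6 | h6 | h6
    · exact .inl ⟨g, hg, h6⟩
    · exact .inr (.inl ⟨g, hg, h6⟩)
    · exact .inr (.inr ⟨g, hg, h6⟩)

theorem not_branchClosed (hv : A.IsValuation L val) {θ : Branch (Θ.extend ℕ)}
    (hcl : ∀ e ∈ θ, e.Closed) {g : (Θ.extend ℕ).Const → A.diagram.Const}
    (hg : ∀ e ∈ θ, e.Holds val g) : ¬ BranchClosed L θ := by
  rintro (⟨l, l', φ, φ', h, h', hvar, hne⟩ | ⟨φ, h⟩ | ⟨rfl, φ, h⟩)
  · have := hv.variant _ _ (Formula.Closed.mapConst (hcl _ h)) (Formula.Closed.mapConst (hcl _ h'))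
      (hvar.mapConst (g := g))
    exact hne ((hg _ h).symm.trans (this.trans (hg _ h')))
  · have h1 := hv.box (φ.mapConst g) (Formula.Closed.mapConst (φ := φ) (hcl _ h))
    have h2 : val (.box (φ.mapConst g)) = .t := hg _ h
    rw [h2] at h1
    generalize val (φ.mapConst g) = b at h1
    cases L <;> cases b <;> simp [boxOp] at h1
  · have h1 := hv.box (φ.mapConst g) (Formula.Closed.mapConst (φ := φ) (hcl _ h))
    have h2 : val (.box (φ.mapConst g)) = .f := hg _ h
    rw [h2] at h1
    generalize val (φ.mapConst g) = b at h1
    cases b <;> simp [boxOp] at h1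

/-- A valuation that gives a sentence the value `l` keeps a branch of every tableau that starts from
the sentence signed with `l` true. -/
theorem IsTableau.exists_holds (hv : A.IsValuation L val) {l : TV} {φ : Formula (Θ.extend ℕ)}
    (hφ : φ.Closed) {g : (Θ.extend ℕ).Const → A.diagram.Const} (hl : val (φ.mapConst g) = l)
    {𝓕 : List (Branch (Θ.extend ℕ))} (h : IsTableau L l φ 𝓕) :
    ∃ θ ∈ 𝓕, (∀ e ∈ θ, e.Closed) ∧
      ∃ g' : (Θ.extend ℕ).Const → A.diagram.Const, ∀ e ∈ θ, e.Holds val g' := by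
  induction h with
  | refl => exact ⟨_, List.mem_singleton_self _, by simpa [Entry.Closed] using hφ, g,
      by simpa [Entry.Holds] using hl⟩
  | tail _ hs ih =>
    obtain ⟨𝓕₁, 𝓕₂, θ, alts, rfl, hE, rfl⟩ := hs
    obtain ⟨θ', hθ', hcl, g', hg'⟩ := ih
    simp only [List.mem_append, List.mem_cons] at hθ'
    rcases hθ' with h | rfl | h
    · exact ⟨θ', by simp [h], hcl, g', hg'⟩
    · obtain ⟨alt, halt, g'', hg''⟩ := hE.sound hv hcl hg'
      refine ⟨θ' ++ alt, by simp [halt], fun e he => ?_, g'', hg''⟩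
      exact (List.mem_append.1 he).elim (hcl e) (hE.closed hcl alt halt e)
    · exact ⟨θ', by simp [h], hcl, g', hg'⟩

end Soundness

theorem designated_lift_impChain {L : Logic} {A : ModalStructure.{u, v, w} Θ}
    {val : Formula A.diagram → TV} (hv : A.IsValuation L val) {Γ : List (Formula Θ)} {φ : Formula Θ}
    (hΓ : ∀ γ ∈ Γ, γ.Closed) (hφ : φ.Closed) :
    val ((Formula.impChain Γ φ).lift A.NewName) ∈ Designated ↔
      ((∀ γ ∈ Γ, val (γ.lift A.NewName) ∈ Designated) → val (φ.lift A.NewName) ∈ Designated) := by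
  induction Γ with
  | nil => simp [Formula.impChain]
  | cons γ Γ ih =>
    simp only [List.mem_cons, forall_eq_or_imp] at hΓ ⊢
    have h := hv.imp _ _ (hΓ.1.lift A.NewName) ((Formula.closed_impChain hΓ.2 hφ).lift A.NewName)
    rw [and_imp]
    refine Iff.trans ?_ (imp_congr_right fun _ => ih hΓ.2)
    change val (.imp (γ.lift _) ((Formula.impChain Γ φ).lift _)) ∈ Designated ↔ _
    refine ⟨fun h1 h2 => designated_of_imp h h2 h1, fun h1 => ?_⟩
    by_contra h2
    exact (undesignated_imp h h2).2 (h1 (undesignated_imp h h2).1)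

theorem ModalStructure.constU_surjective (A : ModalStructure.{u, v, w} Θ) :
    Function.Surjective A.constU := by
  intro a
  by_cases h : a ∈ Set.range A.const
  · obtain ⟨c, rfl⟩ := h
    exact ⟨.inl c, rfl⟩
  · exact ⟨.inr ⟨a, h⟩, rfl⟩

theorem ModalStructure.nonempty_diagram_const (A : ModalStructure.{u, v, w} Θ) :
    Nonempty A.diagram.Const :=
  A.nonempty.map fun a => (A.constU_surjective a).choose

/-- For sentences, consequence is about the sentences themselves and reduces to the validity of a
chain of implications. -/
theorem semCons_iff (L : Logic) {Γ : List (Formula Θ)} {φ : Formula Θ}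
    (hΓ : ∀ γ ∈ Γ, γ.Closed) (hφ : φ.Closed) :
    SemCons.{u, v, w} L {γ | γ ∈ Γ} φ ↔
      ∀ (A : ModalStructure.{u, v, w} Θ) (val : Formula A.diagram → TV), A.IsValuation L val →
        val ((Formula.impChain Γ φ).lift A.NewName) ∈ Designated := by
  refine forall_congr' fun A => forall_congr' fun val => forall_congr' fun hv => ?_
  have := A.nonempty_diagram_const
  rw [designated_lift_impChain hv hΓ hφ]
  refine imp_congr ?_ ?_
  · refine forall_congr' fun γ => forall_congr' fun hγ => ?_
    simp only [((hΓ γ hγ).lift A.NewName).subst_eq, forall_const]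
  · simp only [(hφ.lift A.NewName).subst_eq, forall_const]

theorem TabProvable.valid {L : Logic} {φ : Formula Θ} (hφ : φ.Closed) (h : TabProvable L φ)
    (A : ModalStructure.{u, v, w} Θ) (val : Formula A.diagram → TV) (hv : A.IsValuation L val) :
    val (φ.lift A.NewName) ∈ Designated := by
  by_contra hl
  obtain ⟨𝓕, h𝓕, hcl⟩ := h _ (mem_undesignated.1 hl)
  obtain ⟨d⟩ := A.nonempty_diagram_const
  obtain ⟨θ, hθ, h1, g, h2⟩ := h𝓕.exists_holds hv (hφ.lift ℕ)
    (g := Sum.elim Sum.inl fun _ => d) (congrArg val (Formula.mapConst_lift fun c _ => rfl))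
  exact not_branchClosed hv h1 h2 (hcl θ hθ)

/-! ### Closing a tableau branch by branch -/

/-- The branch `θ` is the root of some closed tableau. -/
inductive Closable (L : Logic) : Branch Θ → Prop
  | closed {θ : Branch Θ} (h : BranchClosed L θ) : Closable L θ
  | expand {θ : Branch Θ} {alts : List (List (Entry Θ))} (h : Expands L θ alts)
      (ih : ∀ alt ∈ alts, Closable L (θ ++ alt)) : Closable L θ

theorem Step.append {L : Logic} {𝓕 𝓕' : List (Branch Θ)} (h : Step L 𝓕 𝓕')
    (𝓖 𝓖' : List (Branch Θ)) : Step L (𝓖 ++ 𝓕 ++ 𝓖') (𝓖 ++ 𝓕' ++ 𝓖') := by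
  obtain ⟨𝓕₁, 𝓕₂, θ, alts, rfl, hE, rfl⟩ := h
  exact ⟨𝓖 ++ 𝓕₁, 𝓕₂ ++ 𝓖', θ, alts, by simp, hE, by simp⟩

/-- Tableaux for the branches of a list can be grown independently of each other. -/
theorem exists_closed_of_forall {L : Logic} {𝓕 : List (Branch Θ)}
    (h : ∀ θ ∈ 𝓕, ∃ 𝓖, Relation.ReflTransGen (Step L) [θ] 𝓖 ∧ ∀ θ ∈ 𝓖, BranchClosed L θ) :
    ∃ 𝓖, Relation.ReflTransGen (Step L) 𝓕 𝓖 ∧ ∀ θ ∈ 𝓖, BranchClosed L θ := by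
  induction 𝓕 with
  | nil => exact ⟨[], .refl, by simp⟩
  | cons θ 𝓕 ih =>
    simp only [List.mem_cons, forall_eq_or_imp] at h
    obtain ⟨𝓖, h1, h2⟩ := h.1
    obtain ⟨𝓖', h1', h2'⟩ := ih h.2
    refine ⟨𝓖 ++ 𝓖', ?_, fun θ hθ => (List.mem_append.1 hθ).elim (h2 θ) (h2' θ)⟩
    have h3 := h1.lift (p := Step L) (fun 𝓗 => 𝓗 ++ 𝓕) fun a b hab => by
      simpa using hab.append [] 𝓕
    have h4 := h1'.lift (p := Step L) (fun 𝓗 => 𝓖 ++ 𝓗) fun a b hab => by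
      simpa using hab.append 𝓖 []
    exact h3.trans h4

theorem Closable.exists_closed {L : Logic} {θ : Branch Θ} (h : Closable L θ) :
    ∃ 𝓖, Relation.ReflTransGen (Step L) [θ] 𝓖 ∧ ∀ θ ∈ 𝓖, BranchClosed L θ := by
  induction h with
  | @closed θ h => exact ⟨[θ], .refl, by simpa using h⟩
  | @expand θ alts hE _ ih =>
    obtain ⟨𝓖, h1, h2⟩ := exists_closed_of_forall (L := L) (𝓕 := alts.map (θ ++ ·))
      (by simpa using ih)
    refine ⟨𝓖, .head ?_ h1, h2⟩
    exact ⟨[], [], θ, alts, rfl, hE, by simp⟩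

/-! ### Saturated open branches -/

open Entry in
/-- What a signed formula of a saturated branch asks for: `Demand L e j l φ D` says that one of the
lists in `D` has to be on the branch if `l : φ` is. The quantifiers are to be instantiated with the
constants listed by `e`; `j` is the index of the constant at hand. -/
inductive Demand (L : Logic) (e : ℕ → Θ.Const) (j : ℕ) :
    TV → Formula Θ → Set (List (Entry Θ)) → Prop
  | prop {l : TV} {φ : Formula Θ} {alts : List (List (Entry Θ))} (h : PropRule L l φ alts) :
      Demand L e j l φ {alt | alt ∈ alts}
  | allT (x : ℕ) (φ : Formula Θ) :
      Demand L e j .T (.all x φ) {[signed .T (φ.subst₁ x (.const (e j)))]}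
  | allF (x : ℕ) (φ : Formula Θ) :
      Demand L e j .F (.all x φ) {alt | ∃ n, alt = [signed .F (φ.subst₁ x (.const (e n)))]}
  | allt (x : ℕ) (φ : Formula Θ) :
      Demand L e j .t (.all x φ) {alt | ∃ n, ∃ l ∈ ({.t, .T} : Set TV), alt =
        [signed .t (φ.subst₁ x (.const (e n))), signed l (φ.subst₁ x (.const (e j)))]}
  | allf (x : ℕ) (φ : Formula Θ) :
      Demand L e j .f (.all x φ) {alt | ∃ n, ∃ l ∈ ({.f, .T, .t} : Set TV), alt =
        [signed .f (φ.subst₁ x (.const (e n))), signed l (φ.subst₁ x (.const (e j)))]}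

theorem PropRule.unique {L : Logic} {l : TV} {φ : Formula Θ} {alts alts' : List (List (Entry Θ))}
    (h : PropRule L l φ alts) (h' : PropRule L l φ alts') : alts = alts' := by
  cases h <;> cases h' <;> rfl

theorem Demand.unique {L : Logic} {e : ℕ → Θ.Const} {j : ℕ} {l : TV} {φ : Formula Θ}
    {D D' : Set (List (Entry Θ))} (h : Demand L e j l φ D) (h' : Demand L e j l φ D') : D = D' := by
  cases h with
  | prop h =>
    cases h' with
    | prop h' => rw [h.unique h']
    | _ => cases h
  | _ =>
    cases h' with
    | prop h' => cases h'
    | _ => rfl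

/-- A set of entries that satisfies all demands and is not closed. -/
structure IsHintikka (L : Logic) (e : ℕ → Θ.Const) (H : Set (Entry Θ)) : Prop where
  closed : ∀ l φ, Entry.signed l φ ∈ H → φ.Closed
  consistent : ∀ l l' φ φ', Entry.signed l φ ∈ H → Entry.signed l' φ' ∈ H → φ.Variant φ' → l = l'
  not_t_box : ∀ φ, Entry.signed .t (.box φ) ∉ H
  not_f_box : L = .S5m → ∀ φ, Entry.signed .f (.box φ) ∉ H
  saturated : ∀ j l φ D, Entry.signed l φ ∈ H → Demand L e j l φ D → ∃ alt ∈ D, ∀ a ∈ alt, a ∈ H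

/-- The branches from which a saturated branch is built: they cannot be closed, and they record with
every mark that the marked formula has been instantiated with a constant listed by `e`. -/
structure IsOpen (L : Logic) (e : ℕ → Θ.Const) (θ : Branch Θ) : Prop where
  not_closable : ¬ Closable L θ
  closed : ∀ a ∈ θ, a.Closed
  marked : ∀ l x φ c, Entry.marked l x φ c ∈ θ →
    Entry.signed l (φ.subst₁ x (.const c)) ∈ θ ∧ c ∈ Set.range e

theorem IsOpen.expand {L : Logic} {e : ℕ → Θ.Const} {θ : Branch Θ} (h : IsOpen L e θ)
    {alts : List (List (Entry Θ))} (hE : Expands L θ alts)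
    (hm : ∀ alt ∈ alts, ∀ l x φ c, Entry.marked l x φ c ∈ alt →
      Entry.signed l (φ.subst₁ x (.const c)) ∈ alt ∧ c ∈ Set.range e) :
    ∃ alt ∈ alts, IsOpen L e (θ ++ alt) := by
  by_contra! hno
  refine h.not_closable (.expand hE fun alt halt => ?_)
  by_contra hcl
  refine hno alt halt ⟨hcl, fun a ha => ?_, fun l x φ c hc => ?_⟩
  · exact (List.mem_append.1 ha).elim (h.closed a) (hE.closed h.closed alt halt a)
  · rcases List.mem_append.1 hc with hc | hc
    · exact (h.marked l x φ c hc).imp_left (List.mem_append_left _)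
    · exact (hm alt halt l x φ c hc).imp_left (List.mem_append_right _)

theorem Entry.finite_consts (a : Entry Θ) : a.consts.Finite := by
  cases a with
  | signed l φ => exact φ.finite_consts
  | marked l x φ c => exact φ.finite_consts.insert c

theorem exists_fresh {e : ℕ → Θ.Const} (he : (Set.range e).Infinite) (θ : Branch Θ) :
    ∃ n, Fresh (e n) θ := by
  have hfin : (⋃ a ∈ {a | a ∈ θ}, a.consts).Finite :=
    (List.finite_toSet θ).biUnion fun a _ => a.finite_consts
  obtain ⟨_, ⟨n, rfl⟩, hn⟩ := he.exists_notMem_finite hfin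
  refine ⟨n, fun a ha hc => hn ?_⟩
  simp only [Set.mem_iUnion]
  exact ⟨a, ha, hc⟩

/-- The first use of a rule that needs a fresh constant; afterwards the branch carries the mark. -/
theorem IsOpen.exists_marked {L : Logic} {e : ℕ → Θ.Const} (he : (Set.range e).Infinite)
    {θ : Branch Θ} (h : IsOpen L e θ) {l : TV} {x : ℕ} {φ : Formula Θ} (hl : l ≠ .T)
    (hφ : Entry.signed l (.all x φ) ∈ θ) :
    ∃ θ', IsOpen L e θ' ∧ θ <+: θ' ∧ ∃ c, Entry.marked l x φ c ∈ θ' := by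
  by_cases hfirst : ∀ d, Entry.marked l x φ d ∉ θ
  · obtain ⟨n, hn⟩ := exists_fresh he θ
    -- The first use of the rules for `t` and `f` also takes a second constant, which may be any.
    obtain ⟨_, ⟨m, rfl⟩, hm⟩ := he.exists_notMem_finite (Set.finite_singleton (e n))
    have hm : e m ≠ e n := hm
    suffices ∃ alts, Expands L θ alts ∧ ∀ alt ∈ alts,
        (∀ l x φ c, Entry.marked l x φ c ∈ alt →
          Entry.signed l (φ.subst₁ x (.const c)) ∈ alt ∧ c ∈ Set.range e) ∧
        Entry.marked l x φ (e n) ∈ alt by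
      obtain ⟨alts, hE, halts⟩ := this
      obtain ⟨alt, halt, hopen⟩ := h.expand hE fun alt halt => (halts alt halt).1
      exact ⟨_, hopen, List.prefix_append _ _, e n,
        List.mem_append_right _ (halts alt halt).2⟩
    cases l with
    | T => exact absurd rfl hl
    | F =>
      refine ⟨_, .allF (e n) hφ hn hfirst, ?_⟩
      simp +contextual
    | t =>
      refine ⟨_, .allt (e n) (e m) hφ hn hm hfirst, ?_⟩
      simp +contextual
    | f =>
      refine ⟨_, .allf (e n) (e m) hφ hn hm hfirst, ?_⟩
      simp +contextual
  · push Not at hfirst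
    exact ⟨θ, h, List.prefix_refl θ, hfirst⟩

theorem IsOpen.exists_demand {L : Logic} {e : ℕ → Θ.Const} (he : (Set.range e).Infinite)
    {θ : Branch Θ} (h : IsOpen L e θ) {j : ℕ} {l : TV} {φ : Formula Θ} {D : Set (List (Entry Θ))}
    (hφ : Entry.signed l φ ∈ θ) (hD : Demand L e j l φ D) :
    ∃ θ', IsOpen L e θ' ∧ θ <+: θ' ∧ ∃ alt ∈ D, ∀ a ∈ alt, a ∈ θ' := by
  have expand {θ : Branch Θ} (h : IsOpen L e θ) {alts : List (List (Entry Θ))}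
      (hE : Expands L θ alts) (hm : ∀ alt ∈ alts, ∀ l x φ c, Entry.marked l x φ c ∉ alt) :
      ∃ alt ∈ alts, IsOpen L e (θ ++ alt) :=
    h.expand hE fun alt halt l x φ c hc => absurd hc (hm alt halt l x φ c)
  cases hD with
  | prop hr =>
    obtain ⟨alt, halt, h'⟩ := expand h (.prop hφ hr) (by cases hr <;> simp)
    exact ⟨_, h', List.prefix_append _ _, alt, halt, fun a => List.mem_append_right _⟩
  | allT x φ =>
    obtain ⟨alt, halt, h'⟩ := expand h (.allT (e j) hφ) (by simp)
    exact ⟨_, h', List.prefix_append _ _, alt, by simpa using halt,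
      fun a => List.mem_append_right _⟩
  | allF x φ =>
    obtain ⟨θ', h', hpre, c, hc⟩ := h.exists_marked he (by simp) hφ
    obtain ⟨hmem, n, rfl⟩ := h'.marked _ _ _ _ hc
    exact ⟨θ', h', hpre, _, ⟨n, rfl⟩, by simpa using hmem⟩
  | allt x φ =>
    obtain ⟨θ', h', hpre, c, hc⟩ := h.exists_marked he (by simp) hφ
    obtain ⟨hmem, n, rfl⟩ := h'.marked _ _ _ _ hc
    by_cases hjn : e j = e n
    · exact ⟨θ', h', hpre, _, ⟨n, .t, by simp, rfl⟩, by simpa [hjn] using hmem⟩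
    · obtain ⟨alt, halt, h''⟩ := expand h' (.allt_again (e n) (e j) hc hjn) (by simp)
      refine ⟨_, h'', hpre.trans (List.prefix_append _ _), ?_⟩
      simp only [List.mem_cons, List.not_mem_nil, or_false] at halt
      rcases halt with rfl | rfl
      · exact ⟨_, ⟨n, .t, by simp, rfl⟩, by simp [hmem]⟩
      · exact ⟨_, ⟨n, .T, by simp, rfl⟩, by simp [hmem]⟩
  | allf x φ =>
    obtain ⟨θ', h', hpre, c, hc⟩ := h.exists_marked he (by simp) hφ
    obtain ⟨hmem, n, rfl⟩ := h'.marked _ _ _ _ hc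
    by_cases hjn : e j = e n
    · exact ⟨θ', h', hpre, _, ⟨n, .f, by simp, rfl⟩, by simpa [hjn] using hmem⟩
    · obtain ⟨alt, halt, h''⟩ := expand h' (.allf_again (e n) (e j) hc hjn) (by simp)
      refine ⟨_, h'', hpre.trans (List.prefix_append _ _), ?_⟩
      simp only [List.mem_cons, List.not_mem_nil, or_false] at halt
      rcases halt with rfl | rfl | rfl
      · exact ⟨_, ⟨n, .f, by simp, rfl⟩, by simp [hmem]⟩
      · exact ⟨_, ⟨n, .T, by simp, rfl⟩, by simp [hmem]⟩
      · exact ⟨_, ⟨n, .t, by simp, rfl⟩, by simp [hmem]⟩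

theorem IsOpen.exists_next {L : Logic} {e : ℕ → Θ.Const} (he : (Set.range e).Infinite)
    {θ : Branch Θ} (h : IsOpen L e θ) (i j : ℕ) :
    ∃ θ', IsOpen L e θ' ∧ θ <+: θ' ∧ ∀ l φ D, θ[i]? = some (Entry.signed l φ) →
      Demand L e j l φ D → ∃ alt ∈ D, ∀ a ∈ alt, a ∈ θ' := by
  by_cases hex : ∃ l φ D, θ[i]? = some (Entry.signed l φ) ∧ Demand L e j l φ D
  · obtain ⟨l, φ, D, hi, hD⟩ := hex
    obtain ⟨θ', h1, h2, h3⟩ := h.exists_demand he (List.mem_of_getElem? hi) hD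
    refine ⟨θ', h1, h2, fun l' φ' D' hi' hD' => ?_⟩
    rw [hi] at hi'
    simp only [Option.some.injEq, Entry.signed.injEq] at hi'
    obtain ⟨rfl, rfl⟩ := hi'
    rwa [hD'.unique hD]
  · exact ⟨θ, h, List.prefix_refl θ, fun l φ D hi hD => absurd ⟨l, φ, D, hi, hD⟩ hex⟩

/-- A branch that cannot be closed extends to a Hintikka set: the demands of its entries are met one
after the other, each pair of an entry and a constant being considered infinitely often. -/
theorem exists_isHintikka {L : Logic} {e : ℕ → Θ.Const} (he : (Set.range e).Infinite)
    {θ : Branch Θ} (h : IsOpen L e θ) : ∃ H, IsHintikka L e H ∧ ∀ a ∈ θ, a ∈ H := by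
  choose next hopen hpre hnext using
    fun (θ : {θ : Branch Θ // IsOpen L e θ}) (i j : ℕ) => θ.2.exists_next he i j
  -- The stage `n` codes a position `i` on the branch, the index `j` of a constant, and a counter
  -- that makes the pair `(i, j)` come up again and again.
  let s : ℕ → {θ : Branch Θ // IsOpen L e θ} := fun n => Nat.rec ⟨θ, h⟩
    (fun n θ => ⟨next θ n.unpair.1.unpair.1 n.unpair.1.unpair.2, hopen _ _ _⟩) n
  have mono : ∀ m n, m ≤ n → (s m).1 <+: (s n).1 := by
    intro m n hmn
    induction hmn with
    | refl => exact List.prefix_refl _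
    | step _ ih => exact ih.trans (hpre _ _ _)
  have mem_max {a a' : Entry Θ} (ha : ∃ n, a ∈ (s n).1) (ha' : ∃ n, a' ∈ (s n).1) :
      ∃ n, a ∈ (s n).1 ∧ a' ∈ (s n).1 := by
    obtain ⟨n, hn⟩ := ha
    obtain ⟨n', hn'⟩ := ha'
    exact ⟨max n n', (mono _ _ (le_max_left _ _)).subset hn,
      (mono _ _ (le_max_right _ _)).subset hn'⟩
  refine ⟨{a | ∃ n, a ∈ (s n).1}, ⟨?_, ?_, ?_, ?_, ?_⟩, fun a ha => ⟨0, ha⟩⟩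
  · rintro l φ ⟨n, hn⟩
    exact (s n).2.closed _ hn
  · intro l l' φ φ' hl hl' hvar
    obtain ⟨n, hn, hn'⟩ := mem_max hl hl'
    by_contra hne
    exact (s n).2.not_closable (.closed (.inl ⟨l, l', φ, φ', hn, hn', hvar, hne⟩))
  · rintro φ ⟨n, hn⟩
    exact (s n).2.not_closable (.closed (.inr (.inl ⟨φ, hn⟩)))
  · rintro hL φ ⟨n, hn⟩
    exact (s n).2.not_closable (.closed (.inr (.inr ⟨hL, φ, hn⟩)))
  · rintro j l φ D ⟨k, hk⟩ hD
    obtain ⟨i, hi⟩ := List.mem_iff_getElem?.1 hk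
    have hi' := (List.prefix_iff_getElem?.1 (mono k _ (Nat.right_le_pair (Nat.pair i j) k)) i
      (List.getElem?_eq_some_iff.1 hi).1)
    rw [← List.getElem?_eq_getElem, hi] at hi'
    obtain ⟨alt, halt, hmem⟩ := hnext (s (Nat.pair (Nat.pair i j) k)) i j l φ D hi' hD
    refine ⟨alt, halt, fun a ha => ⟨Nat.pair (Nat.pair i j) k + 1, ?_⟩⟩
    have := hmem a ha
    change a ∈ next _ _ _
    simpa using this

/-! ### The valuation of a Hintikka set -/

open Classical in
/-- A truth value with the property `P` if there is one, and `d` otherwise. -/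
noncomputable def pick (P : TV → Prop) (d : TV) : TV := if h : ∃ l, P l then h.choose else d

theorem pick_spec (P : TV → Prop) (d : TV) : P (pick P d) ∨ pick P d = d := by
  unfold pick
  split_ifs with h
  · exact .inl h.choose_spec
  · exact .inr rfl

theorem pick_eq {P : TV → Prop} {d l : TV} (hl : P l) (h : ∀ l', P l' → l' = l) :
    pick P d = l := by
  unfold pick
  rw [dif_pos ⟨l, hl⟩]
  exact h _ (Exists.choose_spec _)

/-- The constant denoted by a term when the variables denote the constants `ρ n`. -/
def Term.eval {K : Type*} (ρ : ℕ → K) : Term K → K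
  | .var n => ρ n
  | .const c => c

/-- The valuation determined by a set `H` of entries, at a formula whose variables are interpreted
by constants. The multioperators of `□` and `→` leave a choice, which is made as `H` requires; what `H`
says is looked up modulo variance of the immediate subformulas, so that variants get the same value,
and no inversion of the relation of variance is needed to compare the value of a formula with the
values of its subformulas. Quantifiers range over the constants listed by `e`. -/
noncomputable def canonVal (L : Logic) (e : ℕ → Θ.Const) (H : Set (Entry Θ)) :
    Formula Θ → (ℕ → Θ.Const) → TV
  | .atom p τ, ρ =>
    pick (fun l => Entry.signed l (.atom p fun i => .const ((τ i).eval ρ)) ∈ H) .T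
  | .neg φ, ρ => negVal (canonVal L e H φ ρ)
  | .box φ, ρ =>
    pick (fun l => ∃ φ', Entry.signed l (.box φ') ∈ H ∧
        φ'.Variant (φ.subst fun n => .const (ρ n)))
      (boxOp_nonempty L (canonVal L e H φ ρ)).some
  | .imp φ ψ, ρ =>
    pick (fun l => ∃ φ' ψ', Entry.signed l (.imp φ' ψ') ∈ H ∧
        φ'.Variant (φ.subst fun n => .const (ρ n)) ∧ ψ'.Variant (ψ.subst fun n => .const (ρ n)))
      (impOp_nonempty (canonVal L e H φ ρ) (canonVal L e H ψ ρ)).some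
  | .all x φ, ρ => allVal {l | ∃ n, l = canonVal L e H φ (Function.update ρ x (e n))}

section canonVal

variable {L : Logic} {e : ℕ → Θ.Const} {H : Set (Entry Θ)}

theorem canonVal_congr {φ : Formula Θ} {ρ ρ' : ℕ → Θ.Const} (h : ∀ n ∈ φ.freeVars, ρ n = ρ' n) :
    canonVal L e H φ ρ = canonVal L e H φ ρ' := by
  induction φ generalizing ρ ρ' with
  | atom p τ =>
    have h' (i) : (τ i).eval ρ = (τ i).eval ρ' := by
      cases hi : τ i with
      | var n => exact h n ⟨i, hi⟩
      | const c => rfl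
    simp only [canonVal, h']
  | neg φ ih => simp only [canonVal, ih h]
  | box φ ih =>
    have h1 := Formula.subst_congr (φ := φ) (σ := fun n => .const (ρ n))
      (σ' := fun n => .const (ρ' n)) fun n hn => congrArg Term.const (h n hn)
    simp only [canonVal, ih h, h1]
  | imp φ ψ ih ih' =>
    have h1 := Formula.subst_congr (φ := φ) (σ := fun n => .const (ρ n))
      (σ' := fun n => .const (ρ' n)) fun n hn => congrArg Term.const (h n (.inl hn))
    have h2 := Formula.subst_congr (φ := ψ) (σ := fun n => .const (ρ n))
      (σ' := fun n => .const (ρ' n)) fun n hn => congrArg Term.const (h n (.inr hn))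
    simp only [canonVal, ih fun n hn => h n (.inl hn), ih' fun n hn => h n (.inr hn), h1, h2]
  | all x φ ih =>
    simp only [canonVal]
    congr 2
    funext l
    refine propext (exists_congr fun n => ?_)
    rw [ih]
    intro m hm
    by_cases hx : m = x
    · simp [hx]
    · simpa [Function.update_of_ne hx] using h m ⟨hm, hx⟩

theorem canonVal_all_of_notMem {x : ℕ} {φ : Formula Θ} (h : x ∉ φ.freeVars) (ρ : ℕ → Θ.Const) :
    canonVal L e H (.all x φ) ρ = canonVal L e H φ ρ := by
  rw [canonVal, ← allVal_singleton (canonVal L e H φ ρ)]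
  congr 1
  ext l
  have h' (n : ℕ) : canonVal L e H φ (Function.update ρ x (e n)) = canonVal L e H φ ρ :=
    canonVal_congr fun m hm => Function.update_of_ne (by rintro rfl; exact h hm) _ _
  simp [h']

theorem canonVal_subst {σ : ℕ → Term Θ.Const} (hσ : IsGrounding σ) (φ : Formula Θ)
    (ρ : ℕ → Θ.Const) :
    canonVal L e H (φ.subst σ) ρ = canonVal L e H φ fun n => (σ n).eval ρ := by
  have comp {σ : ℕ → Term Θ.Const} (hσ : IsGrounding σ) (ρ : ℕ → Θ.Const) (φ : Formula Θ) :
      (φ.subst σ).subst (fun n => .const (ρ n)) = φ.subst fun n => .const ((σ n).eval ρ) := by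
    rw [Formula.subst_subst hσ]
    congr 1
    funext n
    cases σ n <;> rfl
  induction φ generalizing σ ρ with
  | atom p τ =>
    rw [Formula.subst_atom]
    have h (i) : ((τ i).subst σ).eval ρ = (τ i).eval fun n => (σ n).eval ρ := by
      cases τ i <;> rfl
    simp only [canonVal, h]
  | neg φ ih => simp only [Formula.subst, canonVal, ih hσ]
  | box φ ih => simp only [Formula.subst, canonVal, ih hσ, comp hσ]
  | imp φ ψ ih ih' => simp only [Formula.subst, canonVal, ih hσ, ih' hσ, comp hσ]
  | all x φ ih =>
    simp only [Formula.subst, canonVal, ih (hσ.update_var x)]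
    congr 2
    funext l
    refine propext (exists_congr fun n => ?_)
    congr! 2
    funext m
    by_cases hx : m = x
    · subst hx; simp [Term.eval]
    · rcases hσ m with h | ⟨c, h⟩ <;> simp [Function.update_of_ne hx, h, Term.eval]

theorem canonVal_subst₁_const (x : ℕ) (c : Θ.Const) (φ : Formula Θ) (ρ : ℕ → Θ.Const) :
    canonVal L e H (φ.subst₁ x (.const c)) ρ = canonVal L e H φ (Function.update ρ x c) := by
  rw [Formula.subst₁, canonVal_subst (Formula.isGrounding_subst₁ x c)]
  congr 1
  funext n
  by_cases hx : n = x
  · subst hx; simp [Term.eval]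
  · simp [Function.update_of_ne hx, Term.eval]

theorem canonVal_subst₁_var {x y : ℕ} {φ : Formula Θ} (hf : φ.FreeFor y x) (ρ : ℕ → Θ.Const) :
    canonVal L e H (φ.subst₁ x (.var y)) ρ = canonVal L e H φ (Function.update ρ x (ρ y)) := by
  have comp {φ : Formula Θ} (hf : φ.FreeFor y x) (ρ : ℕ → Θ.Const) :
      (φ.subst₁ x (.var y)).subst (fun n => .const (ρ n)) =
        φ.subst fun n => .const (Function.update ρ x (ρ y) n) := by
    rw [Formula.subst₁_var_subst hf]
    congr 1
    funext n
    by_cases hx : n = x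
    · subst hx; simp
    · simp [Function.update_of_ne hx]
  induction φ generalizing ρ with
  | atom p τ =>
    rw [Formula.subst₁, Formula.subst_atom]
    have h (i) : ((τ i).subst (Function.update Term.var x (.var y))).eval ρ =
        (τ i).eval (Function.update ρ x (ρ y)) := by
      cases τ i with
      | const c => rfl
      | var n =>
        by_cases hx : n = x
        · subst hx; simp [Term.subst, Term.eval]
        · simp [Term.subst, Term.eval, Function.update_of_ne hx]
    simp only [canonVal, h]
  | neg φ ih =>
    change negVal (canonVal L e H (φ.subst₁ x (.var y)) ρ) = _
    rw [ih hf]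
    rfl
  | box φ ih =>
    change canonVal L e H (.box (φ.subst₁ x (.var y))) ρ = _
    simp only [canonVal, ih hf, comp (show φ.FreeFor y x from hf)]
  | imp φ ψ ih ih' =>
    change canonVal L e H (.imp (φ.subst₁ x (.var y)) (ψ.subst₁ x (.var y))) ρ = _
    simp only [canonVal, ih hf.1, ih' hf.2, comp hf.1, comp hf.2]
  | all z φ ih =>
    by_cases hx : x ∈ (Formula.all z φ).freeVars
    · obtain ⟨hzy, hf⟩ := hf.resolve_left (not_not_intro hx)
      have hxz : z ≠ x := fun h => hx.2 h.symm
      have h1 : (Formula.all z φ).subst₁ x (.var y) = .all z (φ.subst₁ x (.var y)) := by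
        simp only [Formula.subst₁, Formula.subst]
        rw [Function.update_comm hxz.symm, Function.update_eq_self]
      rw [h1]
      simp only [canonVal, ih hf, Function.update_of_ne hzy.symm, Function.update_comm hxz]
    · have h1 : (Formula.all z φ).subst₁ x (.var y) = .all z φ := by
        conv_rhs => rw [← Formula.subst_var (.all z φ)]
        refine Formula.subst_congr fun n hn => Function.update_of_ne ?_ _ _
        rintro rfl
        exact hx hn
      rw [h1]
      refine canonVal_congr fun n hn => (Function.update_of_ne ?_ _ _).symm
      rintro rfl
      exact hx hn

theorem canonVal_variant {φ ψ : Formula Θ} (h : φ.Variant ψ) (ρ : ℕ → Θ.Const) :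
    canonVal L e H φ ρ = canonVal L e H ψ ρ := by
  have iff {φ φ' χ : Formula Θ} (h : φ.Variant φ') (ρ : ℕ → Θ.Const) :
      χ.Variant (φ.subst fun n => .const (ρ n)) ↔ χ.Variant (φ'.subst fun n => .const (ρ n)) :=
    ⟨fun h' => h'.trans (h.subst (isGrounding_const ρ)),
      fun h' => h'.trans (h.subst (isGrounding_const ρ)).symm⟩
  induction h generalizing ρ with
  | voidAll x φ h => exact canonVal_all_of_notMem h ρ
  | voidEx x φ h =>
    rw [canonVal, canonVal_all_of_notMem (φ := .neg φ) h, canonVal, negVal_negVal]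
  | rename x y φ hy hf =>
    simp only [canonVal, canonVal_subst₁_var hf, Function.update_self]
    congr 2
    funext l
    refine propext (exists_congr fun n => ?_)
    rw [canonVal_congr]
    intro m hm
    have hmy : m ≠ y := by rintro rfl; exact hy hm
    by_cases hx : m = x
    · simp [hx]
    · simp [Function.update_of_ne hx, Function.update_of_ne hmy]
  | neg _ ih => simp only [canonVal, ih]
  | box h ih => simp only [canonVal, ih, iff h]
  | imp h h' ih ih' => simp only [canonVal, ih, ih', iff h, iff h']
  | all x _ ih => simp only [canonVal, ih]
  | refl φ => rfl
  | symm _ ih => exact (ih ρ).symm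
  | trans _ _ ih ih' => exact (ih ρ).trans (ih' ρ)

/-- A Hintikka set is true under its valuation. The induction is on the form of a formula whose
variables may still be replaced by constants. -/
theorem IsHintikka.canonVal_subst_eq (hH : IsHintikka L e H) {l : TV} {φ : Formula Θ}
    {σ : ℕ → Term Θ.Const} (hσ : IsGrounding σ) (h : Entry.signed l (φ.subst σ) ∈ H)
    (ρ : ℕ → Θ.Const) : canonVal L e H (φ.subst σ) ρ = l := by
  induction φ generalizing l σ ρ with
  | atom p τ =>
    have hcl := hH.closed _ _ h
    rw [← hcl.subst_eq fun n => .const (ρ n)] at h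
    rw [Formula.subst_atom] at h ⊢
    rw [Formula.subst_atom] at h
    have hτ (i) : ((τ i).subst σ).subst (fun n => .const (ρ n)) =
        .const (((τ i).subst σ).eval ρ) := by
      cases (τ i).subst σ <;> rfl
    simp only [hτ] at h
    exact pick_eq h fun l' h' => hH.consistent _ _ _ _ h' h (.refl _)
  | neg φ ih =>
    simp only [Formula.subst] at h ⊢
    have hr {l l' : TV} (hD : PropRule L l (.neg (φ.subst σ)) [[.signed l' (φ.subst σ)]])
        (h : Entry.signed l (.neg (φ.subst σ)) ∈ H) : canonVal L e H (φ.subst σ) ρ = l' := by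
      obtain ⟨alt, halt, hmem⟩ := hH.saturated 0 _ _ _ h (.prop hD)
      obtain rfl : alt = _ := by simpa using halt
      exact ih hσ (hmem _ (by simp)) ρ
    cases l
    · rw [canonVal, hr (.negT _) h]; rfl
    · rw [canonVal, hr (.negt _) h]; rfl
    · rw [canonVal, hr (.negf _) h]; rfl
    · rw [canonVal, hr (.negF _) h]; rfl
  | box φ ih =>
    have hcl : (φ.subst σ).Closed := hH.closed _ (.box (φ.subst σ)) h
    refine pick_eq ⟨_, h, ?_⟩ ?_
    · rw [hcl.subst_eq]; exact .refl _
    · rintro l' ⟨φ', h', hvar⟩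
      rw [hcl.subst_eq] at hvar
      exact hH.consistent _ _ _ _ h' h (.box hvar)
  | imp φ ψ ih ih' =>
    have hcl := Set.union_empty_iff.1 (hH.closed _ _ h)
    have h1 : (φ.subst σ).Closed := hcl.1
    have h2 : (ψ.subst σ).Closed := hcl.2
    refine pick_eq ⟨_, _, h, ?_, ?_⟩ ?_
    · rw [h1.subst_eq]; exact .refl _
    · rw [h2.subst_eq]; exact .refl _
    · rintro l' ⟨φ', ψ', h', hvar, hvar'⟩
      rw [h1.subst_eq] at hvar
      rw [h2.subst_eq] at hvar'
      exact hH.consistent _ _ _ _ h' h (.imp hvar hvar')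
  | all x φ ih =>
    set φ' := φ.subst (Function.update σ x (.var x)) with hφ'
    change Entry.signed l (.all x φ') ∈ H at h
    change canonVal L e H (.all x φ') ρ = l
    have inst {l' : TV} {c : Θ.Const} (h : Entry.signed l' (φ'.subst₁ x (.const c)) ∈ H) :
        canonVal L e H φ' (Function.update ρ x c) = l' := by
      have h1 : φ'.subst₁ x (.const c) = φ.subst (Function.update σ x (.const c)) := by
        rw [hφ', Formula.subst₁, Formula.subst_subst (hσ.update_var x)]
        congr 1
        funext n
        by_cases hx : n = x
        · subst hx; simp [Term.subst]
        · rcases hσ n with h | ⟨c, h⟩ <;> simp [Function.update_of_ne hx, h, Term.subst]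
      rw [← canonVal_subst₁_const]
      rw [h1] at h ⊢
      exact ih (hσ.update_const x c) h ρ
    rw [canonVal]
    apply allVal_eq
    cases l with
    | T =>
      refine T_mem_allOp.2 ?_
      rintro _ ⟨j, rfl⟩
      obtain ⟨alt, rfl, hmem⟩ := hH.saturated j _ _ _ h (.allT _ _)
      exact inst (hmem _ (by simp))
    | F =>
      obtain ⟨alt, ⟨n, rfl⟩, hmem⟩ := hH.saturated 0 _ _ _ h (.allF _ _)
      exact F_mem_allOp.2 ⟨n, (inst (hmem _ (by simp))).symm⟩
    | t =>
      refine t_mem_allOp.2 ⟨?_, ?_⟩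
      · obtain ⟨alt, ⟨n, l', -, rfl⟩, hmem⟩ := hH.saturated 0 _ _ _ h (.allt _ _)
        exact ⟨n, (inst (hmem _ (by simp))).symm⟩
      · rintro _ ⟨j, rfl⟩
        obtain ⟨alt, ⟨n, l', hl', rfl⟩, hmem⟩ := hH.saturated j _ _ _ h (.allt _ _)
        rwa [inst (hmem (.signed l' _) (by simp))]
    | f =>
      refine f_mem_allOp.2 ⟨?_, ?_⟩
      · obtain ⟨alt, ⟨n, l', -, rfl⟩, hmem⟩ := hH.saturated 0 _ _ _ h (.allf _ _)
        exact ⟨n, (inst (hmem _ (by simp))).symm⟩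
      · rintro _ ⟨j, rfl⟩
        obtain ⟨alt, ⟨n, l', hl', rfl⟩, hmem⟩ := hH.saturated j _ _ _ h (.allf _ _)
        rwa [inst (hmem (.signed l' _) (by simp))]

theorem IsHintikka.canonVal_eq (hH : IsHintikka L e H) {l : TV} {φ : Formula Θ}
    (h : Entry.signed l φ ∈ H) (ρ : ℕ → Θ.Const) : canonVal L e H φ ρ = l := by
  rw [← Formula.subst_var φ] at h ⊢
  exact hH.canonVal_subst_eq isGrounding_var h ρ

theorem IsHintikka.canonVal_of_variant (hH : IsHintikka L e H) {l : TV} {φ φ' : Formula Θ}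
    {ρ : ℕ → Θ.Const} (h : Entry.signed l φ' ∈ H)
    (hvar : φ'.Variant (φ.subst fun n => .const (ρ n))) : canonVal L e H φ ρ = l := by
  have h1 := canonVal_variant (L := L) (e := e) (H := H) hvar ρ
  rw [hH.canonVal_eq h, canonVal_subst (isGrounding_const ρ)] at h1
  exact h1.symm

theorem IsHintikka.canonVal_box (hH : IsHintikka L e H) (φ : Formula Θ) (ρ : ℕ → Θ.Const) :
    canonVal L e H (.box φ) ρ ∈ boxOp L (canonVal L e H φ ρ) := by
  rw [canonVal]
  rcases pick_spec (fun l => ∃ φ', Entry.signed l (.box φ') ∈ H ∧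
      φ'.Variant (φ.subst fun n => .const (ρ n)))
    (boxOp_nonempty L (canonVal L e H φ ρ)).some with h | h
  · revert h
    generalize pick _ _ = l
    rintro ⟨φ', h, hvar⟩
    have hr {alts} (hr : PropRule L l (.box φ') alts) : ∃ alt ∈ alts, ∀ a ∈ alt, a ∈ H :=
      hH.saturated 0 _ _ _ h (.prop hr)
    have hval {l' : TV} (h' : Entry.signed l' φ' ∈ H) := hH.canonVal_of_variant h' hvar
    cases l with
    | T =>
      have := hr (.boxT φ')
      simp only [List.mem_singleton, exists_eq_left, forall_eq] at this
      rw [hval this]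
      cases L <;> simp [boxOp]
    | t => exact absurd h (hH.not_t_box φ')
    | f =>
      cases L with
      | S5m => exact absurd h (hH.not_f_box rfl φ')
      | S4m =>
        have := hr (.boxf rfl φ')
        simp only [List.mem_cons, List.not_mem_nil, or_false, exists_eq_or_imp, exists_eq_left,
          forall_eq] at this
        rcases this with h | h | h <;> rw [hval h] <;> simp [boxOp]
    | F =>
      have := hr (.boxF φ')
      simp only [List.mem_cons, List.not_mem_nil, or_false, exists_eq_or_imp, exists_eq_left,
        forall_eq] at this
      rcases this with h | h | h <;> rw [hval h] <;> cases L <;> simp [boxOp]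
  · rw [h]
    exact Set.Nonempty.some_mem _

theorem IsHintikka.canonVal_imp (hH : IsHintikka L e H) (φ ψ : Formula Θ) (ρ : ℕ → Θ.Const) :
    canonVal L e H (.imp φ ψ) ρ ∈ impOp (canonVal L e H φ ρ) (canonVal L e H ψ ρ) := by
  rw [canonVal]
  rcases pick_spec (fun l => ∃ φ' ψ', Entry.signed l (.imp φ' ψ') ∈ H ∧
      φ'.Variant (φ.subst fun n => .const (ρ n)) ∧ ψ'.Variant (ψ.subst fun n => .const (ρ n)))
    (impOp_nonempty (canonVal L e H φ ρ) (canonVal L e H ψ ρ)).some with h | h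
  · revert h
    generalize pick _ _ = l
    rintro ⟨φ', ψ', h, hvar, hvar'⟩
    have hr {alts} (hr : PropRule L l (.imp φ' ψ') alts) : ∃ alt ∈ alts, ∀ a ∈ alt, a ∈ H :=
      hH.saturated 0 _ _ _ h (.prop hr)
    have hval {l' : TV} (h' : Entry.signed l' φ' ∈ H) := hH.canonVal_of_variant h' hvar
    have hval' {l' : TV} (h' : Entry.signed l' ψ' ∈ H) := hH.canonVal_of_variant h' hvar'
    cases l with
    | T =>
      have := hr (.impT φ' ψ')
      simp only [List.mem_cons, List.not_mem_nil, or_false, exists_eq_or_imp, exists_eq_left,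
        forall_eq_or_imp, forall_eq] at this
      rcases this with h | ⟨h, h'⟩ | ⟨h, h'⟩ | ⟨h, h'⟩ | h'
      · rw [hval h]; cases canonVal L e H ψ ρ <;> simp [impOp]
      · rw [hval h, hval' h']; simp [impOp]
      · rw [hval h, hval' h']; simp [impOp]
      · rw [hval h, hval' h']; simp [impOp]
      · rw [hval' h']; cases canonVal L e H φ ρ <;> simp [impOp]
    | t =>
      have := hr (.impt φ' ψ')
      simp only [List.mem_cons, List.not_mem_nil, or_false, exists_eq_or_imp, exists_eq_left,
        forall_eq_or_imp, forall_eq] at this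
      rcases this with ⟨h, h'⟩ | ⟨h, h'⟩ | ⟨h, h'⟩ | ⟨h, h'⟩ | ⟨h, h'⟩ <;>
        rw [hval h, hval' h'] <;> simp [impOp]
    | f =>
      have := hr (.impf φ' ψ')
      simp only [List.mem_cons, List.not_mem_nil, or_false, exists_eq_or_imp, exists_eq_left,
        forall_eq_or_imp, forall_eq] at this
      rcases this with ⟨h, h'⟩ | ⟨h, h'⟩ | ⟨h, h'⟩ <;> rw [hval h, hval' h'] <;> simp [impOp]
    | F =>
      have := hr (.impF φ' ψ')
      simp only [List.mem_cons, List.not_mem_nil, or_false, exists_eq_left,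
        forall_eq_or_imp, forall_eq] at this
      rw [hval this.1, hval' this.2]
      simp [impOp]
  · rw [h]
    exact Set.Nonempty.some_mem _

end canonVal

/-! ### Completeness -/

/-- The structure of the natural numbers in which `n` stands for the constant `e n` and the atoms
are evaluated as `H` says. A constant that is not listed by `e`
denotes an arbitrary number. -/
noncomputable def canonStructure (L : Logic) (e : ℕ → (Θ.extend ℕ).Const)
    (H : Set (Entry (Θ.extend ℕ))) : ModalStructure.{u, v, w} Θ where
  U := ULift ℕ
  nonempty := ⟨⟨0⟩⟩
  pred p a := canonVal L e H (.atom (Θ := Θ.extend ℕ) p fun i => .const (e (a i).down)) fun _ => e 0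
  const c := ⟨Classical.epsilon fun n => e n = Sum.inl c⟩

/-- A Hintikka set has a countable model: the diagram constants are read as constants listed by `e`,
and a sentence gets the value of the formula thus obtained. -/
theorem IsHintikka.exists_isValuation {L : Logic} {e : ℕ → (Θ.extend ℕ).Const}
    {H : Set (Entry (Θ.extend ℕ))} (hH : IsHintikka L e H) :
    ∃ (A : ModalStructure.{u, v, w} Θ) (val : Formula A.diagram → TV), A.IsValuation L val ∧
      ∀ l (φ : Formula Θ), (∀ c ∈ φ.consts, Sum.inl c ∈ Set.range e) →
        Entry.signed l (φ.lift ℕ) ∈ H → val (φ.lift A.NewName) = l := by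
  let A : ModalStructure.{u, v, w} Θ := canonStructure L e H
  let g : A.diagram.Const → (Θ.extend ℕ).Const := fun d => e (A.constU d).down
  have hg (n : ℕ) : ∃ d, g d = e n := by
    obtain ⟨d, hd⟩ := A.constU_surjective ⟨n⟩
    exact ⟨d, by simp only [g, hd]⟩
  refine ⟨A, fun φ => canonVal L e H (φ.mapConst g) fun _ => e 0,
    ⟨fun p c => rfl, ?_, ?_, ?_, ?_, ?_⟩, ?_⟩
  · intro φ _
    rw [negOp_eq]
    rfl
  · exact fun φ _ => hH.canonVal_box (φ.mapConst g) _
  · exact fun φ ψ _ _ => hH.canonVal_imp (φ.mapConst g) (ψ.mapConst g) _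
  · intro x φ _
    simp only [Formula.mapConst, canonVal, allOp_eq, Set.mem_singleton_iff]
    congr 1
    ext l
    have h (d : A.diagram.Const) :
        canonVal L e H ((φ.subst₁ x (.const d)).mapConst g) (fun _ => e 0) =
          canonVal L e H (φ.mapConst g) (Function.update (fun _ => e 0) x (g d)) := by
      rw [Formula.mapConst_subst₁, Term.map, canonVal_subst₁_const]
    simp only [Set.mem_ofPred_eq, h]
    constructor
    · rintro ⟨n, rfl⟩
      obtain ⟨d, hd⟩ := hg n
      exact ⟨d, by rw [hd]⟩
    · rintro ⟨d, rfl⟩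
      exact ⟨_, rfl⟩
  · exact fun φ ψ _ _ h => canonVal_variant h.mapConst _
  · intro l φ hc h
    change canonVal L e H ((φ.lift A.NewName).mapConst g) _ = l
    rw [Formula.mapConst_lift (g := g) fun c hcφ => ?_]
    · exact hH.canonVal_eq h _
    · have h' : ∃ n, e n = Sum.inl c := hc c hcφ
      exact Classical.epsilon_spec h'

theorem tabProvable_of_valid {L : Logic} {φ : Formula Θ} (hφ : φ.Closed)
    (h : ∀ (A : ModalStructure.{u, v, w} Θ) (val : Formula A.diagram → TV), A.IsValuation L val →
      val (φ.lift A.NewName) ∈ Designated) : TabProvable L φ := by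
  intro l hl
  -- The constants of `φ` and the new ones are all that matters; there are only countably many.
  obtain ⟨e, he⟩ : ∃ e : ℕ → (Θ.extend ℕ).Const,
      Sum.inl '' φ.consts ∪ Set.range Sum.inr = Set.range e :=
    ((φ.finite_consts.image _).countable.union (Set.countable_range _)).exists_eq_range
      ⟨.inr 0, .inr ⟨0, rfl⟩⟩
  have hinf : (Set.range e).Infinite := by
    rw [← he]
    exact (Set.infinite_range_of_injective Sum.inr_injective).mono Set.subset_union_right
  by_cases hcl : Closable L [Entry.signed l (φ.lift ℕ)]
  · exact hcl.exists_closed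
  · have hopen : IsOpen L e [Entry.signed l (φ.lift ℕ)] :=
      ⟨hcl, by simpa [Entry.Closed] using hφ.lift ℕ, by simp⟩
    obtain ⟨H, hH, hmem⟩ := exists_isHintikka hinf hopen
    obtain ⟨A, val, hv, hval⟩ := hH.exists_isValuation
    have h1 := hval l φ (fun c hc => he ▸ .inl ⟨c, hc, rfl⟩) (hmem _ (by simp))
    exact absurd (h A val hv) (h1 ▸ mem_undesignated.2 hl)

end Ivlev

/-- Soundness and completeness of tableaux for `S4m*` and `S5m*`. The finite set of premises is
given by an arbitrary enumeration. -/
theorem mainTheorem4 (L : Ivlev.Logic) (Θ : Ivlev.Signature.{u, v})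
    (Γ : List (Ivlev.Formula Θ)) (φ : Ivlev.Formula Θ)
    (hΓ : ∀ γ ∈ Γ, γ.Closed) (hφ : φ.Closed) :
    Ivlev.SemCons.{u, v, w} L {γ | γ ∈ Γ} φ ↔ Ivlev.TabProvableFrom L Γ φ := by
  have h := Ivlev.Formula.closed_impChain hΓ hφ
  rw [Ivlev.semCons_iff L hΓ hφ]
  exact ⟨Ivlev.tabProvable_of_valid h, fun h' => h'.valid h⟩
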